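/- **Proposition (characteristic function of the fluctuations).** Let $B(x,r)$ denote the closed Euclidean ball in $\mathbb{R}^d$. *Weights.* Let $\alpha\in(1,2]$, $\sigma\ge 0$, $b\in[-1,1]$, and let $G$ be a probability measure on $\mathbb{R}$ in the normal domain of attraction of the stable law $S_\alpha(\sigma,b,0)$, i.e. the law with characteristic function $\theta\mapsto\exp\big(-\sigma^\alpha|\theta|^\alpha(1-i\,b\,\mathrm{sgn}(\theta)\tan(\pi\alpha/2))\big)$: for i.i.d. $X_i\sim G$ and suitable reals $a_n$, $n^{-1/\alpha}(X_1+\dots+X_n)+a_n$ converges in law to $S_\alpha(\sigma,b,0)$. *Radii.* Let $d<\beta<\alpha d$ and let $f$ be a probability density on $(0,\infty)$ with $f(r)\sim C_\beta r^{-\beta-1}$ as $r\to\infty$ and $f(r)\le C_0r^{-\beta-1}$ for all $r>0$, where $C_\beta,C_0>0$. *Kernels.* Let $k\ge 0$ be measurable on $\mathbb{R}^d\times\mathbb{R}^d$ with $\int_{\mathbb{R}^d} k(x,y)\,dy=1$ for all $x$. Let $\kappa,\lambda,n$ be positive functions on $(0,1)$, $C_1>0$, and let $k_\rho\ge0$ $(0<\rho<1)$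 be measurable on $\mathbb{R}^d\times\mathbb{R}^d$ with $k_\rho(x,y)\sim\lambda(\rho)k(x,y)$ as $\rho\to0$ and $k_\rho(x,y)\le C_1\lambda(\rho)k(x,y)$ for all $x,y$. *Model.* Fix $\rho\in(0,1)$. Let $\Phi_\rho$ be a Poisson point process on $\mathbb{R}^d$ with intensity measure $\kappa(\rho)\,dy$, put $Z_\rho(dx)=\sum_{y\in\Phi_\rho}k_\rho(x,y)\,dx$ and $\Lambda_\rho(dx,dr,dm)=Z_\rho(dx)\,f(r/\rho)\frac{dr}{\rho}\,G(dm)$, and let $C_\rho$ be a Cox process on $\mathbb{R}^d\times\mathbb{R}_+\times\mathbb{R}$ directed by $\Lambda_\rho$, i.e. conditionally on $\Lambda_\rho=\nu$, $C_\rho$ is a Poisson point process with intensity $\nu$. For a finite signed measure $\mu$ on $\mathbb{R}^d$ put $$M_\rho(\mu)=\int m\,\mu(B(x,r))\,C_\rho(dx,dr,dm),\qquad \psi(x)=e^{ix}-1-ix,\qquad \psi_G(u)=\int_{\mathbb{R}}\psi(mu)\,G(dm).$$ Then, for every finite signed measure $\mu$ on $\mathbb{R}^d$: the integral defining $M_\rho(\mu)$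 converges absolutely almost surely, $M_\rho(\mu)$ is integrable, $\psi_G(u)$ is an absolutely convergent integral for all $u\in\mathbb{R}$, and for all $\theta\in\mathbb{R}$ $$\mathbb{E}\left[\exp\left(i\theta\,\frac{M_\rho(\mu)-\mathbb{E}[M_\rho(\mu)\mid\Lambda_\rho]}{n(\rho)}\right)\right]=\exp\left(-\int_{\mathbb{R}^d}\left(1-\exp\left(\int_{\mathbb{R}^d\times\mathbb{R}_+}\psi_G\left(\frac{\theta\mu(B(x,r))}{n(\rho)}\right)k_\rho(x,y)\,dx\,f\left(\frac{r}{\rho}\right)\frac{dr}{\rho}\right)\right)\kappa(\rho)\,dy\right),$$ where the inner integral converges absolutely for almost every $y$ and the outer integral converges absolutely. -/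

import Mathlib

open MeasureTheory ProbabilityTheory Filter Topology Asymptotics
open scoped ENNReal NNReal

noncomputable section

namespace ShotNoiseBalls

/-! ### Point processes, Poisson processes and Cox processes -/

section PointProcess

variable {Ω E : Type*} [MeasurableSpace Ω] [MeasurableSpace E]

/-- A point process on `E`, seen as a random measure: almost surely, `N ω` is locally finite and is
the sum of the Dirac masses at countably many points (possibly with repetitions). -/
structure IsPointProcess [TopologicalSpace E] (N : Ω → Measure E) (P : Measure Ω) : Prop where
  measurable : Measurable N
  locallyFinite : ∀ᵐ ω ∂P, IsLocallyFiniteMeasure (N ω)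
  counting : ∀ᵐ ω ∂P, ∃ (s : Set ℕ) (x : s → E), N ω = Measure.sum fun i => Measure.dirac (x i)

/-- `N` is a Poisson point process on `E` with (`σ`-finite) intensity measure `ν`, under `P`:
`N(A)` is Poisson with parameter `ν(A)` if `ν(A) < ∞`, and the values of `N` on pairwise disjoint
measurable sets are mutually independent. -/
structure IsPoissonProcess [TopologicalSpace E] (N : Ω → Measure E) (ν : Measure E)
    (P : Measure Ω) : Prop where
  isPointProcess : IsPointProcess N P
  sigmaFinite : SigmaFinite ν
  law : ∀ A : Set E, MeasurableSet A → ν A < ∞ →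
    HasLaw (fun ω => N ω A) ((poissonMeasure (ν A).toNNReal).map (fun n : ℕ => (n : ℝ≥0∞))) P
  indep : ∀ (n : ℕ) (A : Fin n → Set E), (∀ i, MeasurableSet (A i)) →
    (∀ i j, i ≠ j → Disjoint (A i) (A j)) → iIndepFun (fun i ω => N ω (A i)) P

/-- `C` is a Cox process on `E` directed by the random measure `Λ`, under `P`: there is a version
`K` of the conditional distribution of `C` given `Λ` such that, for almost every value `ν` of `Λ`,
the canonical random measure is under `K ν` a Poisson point process with intensity `ν`. -/
structure IsCoxProcess [TopologicalSpace E] (C Λ : Ω → Measure E) (P : Measure Ω) : Prop where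
  isPointProcess : IsPointProcess C P
  measurable_directing : Measurable Λ
  conditionally_poisson : ∃ K : Kernel (Measure E) (Measure E), IsMarkovKernel K ∧
    HasCondDistrib C Λ K P ∧
    ∀ᵐ ν ∂(P.map Λ), IsPoissonProcess (fun c : Measure E => c) ν (K ν)

end PointProcess

/-! ### Stable laws and the distribution of the weights -/

/-- `S` is the stable law `S_α(σ, b, 0)` on `ℝ` (for an index `α ≠ 1`). -/
def IsStableLaw (S : Measure ℝ) (α σ b : ℝ) : Prop :=
  ∀ θ : ℝ, charFun S θ =
    Complex.exp (-((σ ^ α * |θ| ^ α : ℝ) : ℂ) *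
      (1 - Complex.I * ((b * SignType.sign θ * Real.tan (Real.pi * α / 2) : ℝ) : ℂ)))

/-- `G` belongs to the normal domain of attraction of `S_α(σ, b, 0)`: if `X₁, X₂, …` are independent
with law `G`, then `(X₁ + ⋯ + Xₙ) / n ^ (1 / α) + aₙ` converges in law to `S_α(σ, b, 0)` for some
real numbers `aₙ`. -/
def InNormalDomainOfAttraction (G : Measure ℝ) [IsProbabilityMeasure G] (α σ b : ℝ) : Prop :=
  ∃ (S : Measure ℝ) (_ : IsProbabilityMeasure S) (a : ℕ → ℝ), IsStableLaw S α σ b ∧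
    TendstoInDistribution
      (fun (n : ℕ) (x : Fin n → ℝ) => (∑ i, x i) / (n : ℝ) ^ (1 / α) + a n) atTop
      (fun x : ℝ => x) (fun n : ℕ => Measure.pi fun _ : Fin n => G) S

/-- `ψ(x) = e^{ix} - 1 - ix`. -/
def psi (x : ℝ) : ℂ := Complex.exp (Complex.I * x) - 1 - Complex.I * x

/-- `ψ_G(u) = ∫ ψ(m u) G(dm)`. -/
def psiG (G : Measure ℝ) (u : ℝ) : ℂ := ∫ m, psi (m * u) ∂G

/-! ### The rescaled random balls model -/

/-- The state space of the centers. -/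
abbrev Space (d : ℕ) := EuclideanSpace ℝ (Fin d)

/-- Marked centers `(x, r, m)`: center, radius, weight. -/
abbrev Marked (d : ℕ) := Space d × ℝ × ℝ

/-- The radius measure `f(r/ρ) dr/ρ` on `(0, ∞)`, as a measure on `ℝ`. -/
def radiusMeasure (f : ℝ → ℝ) (ρ : ℝ) : Measure ℝ :=
  (volume.restrict (Set.Ioi 0)).withDensity fun r => ENNReal.ofReal (f (r / ρ) / ρ)

/-- The shot-noise measure `Z(dx) = ∑_{y ∈ φ} k(x, y) dx` of a configuration `φ`, where the sum over
the points of `φ` (with multiplicity) is the integral against the counting measure `φ`. -/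
def shotNoise {d : ℕ} (k : Space d → Space d → ℝ) (φ : Measure (Space d)) : Measure (Space d) :=
  volume.withDensity fun x => ∫⁻ y, ENNReal.ofReal (k x y) ∂φ

/-- The directing measure `Z(dx) f(r/ρ) dr/ρ G(dm)`. -/
def directing {d : ℕ} (k : Space d → Space d → ℝ) (f : ℝ → ℝ) (ρ : ℝ) (G : Measure ℝ)
    (φ : Measure (Space d)) : Measure (Marked d) :=
  (shotNoise k φ).prod ((radiusMeasure f ρ).prod G)

/-- The weighted mass `m μ(B(x, r))` of a marked ball, with `B(x, r)` the closed ball. -/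
def weightedMass {d : ℕ} (μ : SignedMeasure (Space d)) (z : Marked d) : ℝ :=
  z.2.2 * μ (Metric.closedBall z.1 z.2.1)

/-- `M(μ) = ∫ m μ(B(x, r)) c(dx, dr, dm)` for a configuration `c`. -/
def field {d : ℕ} (μ : SignedMeasure (Space d)) (c : Measure (Marked d)) : ℝ :=
  ∫ z, weightedMass μ z ∂c

/-- The fluctuation `(M(μ) - E[M(μ) | Λ]) / n` for the Cox process `C` directed by `Λ`. -/
def fluctuation {Ω : Type*} [MeasurableSpace Ω] {d : ℕ} (P : Measure Ω)
    (C Λ : Ω → Measure (Marked d)) (μ : SignedMeasure (Space d)) (n : ℝ) (ω : Ω) : ℝ :=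
  (field μ (C ω) -
    (P[fun ω' => field μ (C ω') | MeasurableSpace.comap Λ inferInstance]) ω) / n

/-- The integrand `ψ_G(θ μ(B(x, r)) / n) k(x, y) f(r/ρ) / ρ` as a function of `(x, r)`. -/
def clusterIntegrand {d : ℕ} (k : Space d → Space d → ℝ) (f : ℝ → ℝ) (ρ : ℝ) (G : Measure ℝ)
    (μ : SignedMeasure (Space d)) (n θ : ℝ) (y : Space d) (p : Space d × ℝ) : ℂ :=
  psiG G (θ * μ (Metric.closedBall p.1 p.2) / n) * ((k p.1 y * (f (p.2 / ρ) / ρ) : ℝ) : ℂ)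

/-- The inner integral over `ℝ^d × (0, ∞)`. -/
def clusterExponent {d : ℕ} (k : Space d → Space d → ℝ) (f : ℝ → ℝ) (ρ : ℝ) (G : Measure ℝ)
    (μ : SignedMeasure (Space d)) (n θ : ℝ) (y : Space d) : ℂ :=
  ∫ p, clusterIntegrand k f ρ G μ n θ y p
    ∂((volume : Measure (Space d)).prod (volume.restrict (Set.Ioi (0 : ℝ))))

end ShotNoiseBalls

end

/-!
The directing measure `Λ` is a superposition of clusters: with
`Q y = k_ρ(x, y) dx f(r/ρ) dr/ρ G(dm)` one has `Λ = ∫ Q y Φ(dy)` (`directing_eq_bind`). Hence the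
characteristic function is computed by using the exponential functional of a Poisson process twice.
That functional, `E exp (∫ w dN) = exp (∫ (e ^ w - 1) dν)` for a complex `w` in `L¹(ν)` with
`Re w ≤ 0` (`IsPoissonProcess.integral_exp_integral`), is immediate for simple functions from the
Poisson laws and the independence over disjoint sets, and extends by Campbell's formula because the
exponential is a contraction on the left half-plane.

Given `Λ`, the process `C` is Poisson, so `E[M | Λ] = ∫ m μ(B(x, r)) dΛ` by Campbell's formula
(`IsCoxProcess.condExp_integral`), and the centred field has conditional characteristic function
`exp (∫ ψ(θ m μ(B(x, r)) / n) dΛ)` (`IsCoxProcess.integral_exp_centred`). The exponent is the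
integral over `Φ` of the cluster exponent `W y = ∫ ψ(θ m μ(B(x, r)) / n) dQ y`, whose real part is
non-positive since `Re ψ = cos - 1`; the functional for `Φ` with `w = W` gives the result
(`integral_exp_integral_directing`).

As `|ψ(x)| ≤ 2 |x|`, every integrability claim reduces to the finiteness of
`∫ |m| |μ(B(x, r))| dx f(r/ρ) dr/ρ G(dm)`, that is, to `∫ r ^ d f(r) dr < ∞`, which follows from
`β > d`, and to `∫ |m| dG < ∞`. The latter is extracted from the normal domain of attraction
(`InNormalDomainOfAttraction.integrable_id`): convergence in law forces
`1 - |φ_G(u)|² = O(|u| ^ α)` at `0`, and integrating this against `u⁻² du`, which is possible for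
`α > 1`, bounds `E|X - X'|` for independent `X`, `X'` of law `G`.
-/

namespace ShotNoiseBalls

/-! ### Integrals as functions of the measure -/

section PointProcess

variable {Ω E : Type*} [MeasurableSpace Ω] [MeasurableSpace E]

lemma measurableSet_integrable {F : Type*} [NormedAddCommGroup F] [MeasurableSpace F]
    [BorelSpace F] [SecondCountableTopology F] {g : E → F} (hg : Measurable g) :
    MeasurableSet {c : Measure E | Integrable g c} := by
  have : {c : Measure E | Integrable g c} = {c | ∫⁻ x, ‖g x‖ₑ ∂c < ∞} := by
    ext c
    exact ⟨fun h => h.2, fun h => ⟨hg.aestronglyMeasurable, h⟩⟩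
  rw [this]
  exact measurableSet_lt (Measure.measurable_lintegral hg.enorm) measurable_const

/-- The Bochner integral of a measurable function is a measurable function of the measure. No
`s`-finiteness is required, in contrast to the results on kernels. -/
lemma measurable_integral_measure {g : E → ℝ} (hg : Measurable g) :
    Measurable fun c : Measure E => ∫ x, g x ∂c := by
  classical
  have h : (fun c : Measure E => ∫ x, g x ∂c) = fun c =>
      if Integrable g c then (∫⁻ x, ENNReal.ofReal (g x) ∂c).toReal -
        (∫⁻ x, ENNReal.ofReal (-g x) ∂c).toReal else 0 := by
    ext c
    split_ifs with hc
    · exact integral_eq_lintegral_pos_part_sub_lintegral_neg_part hc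
    · exact integral_undef hc
  rw [h]
  refine Measurable.ite (measurableSet_integrable hg) (Measurable.sub ?_ ?_) measurable_const
  · exact (Measure.measurable_lintegral hg.ennreal_ofReal).ennreal_toReal
  · exact (Measure.measurable_lintegral hg.neg.ennreal_ofReal).ennreal_toReal

lemma measurable_integral_measure_complex {g : E → ℂ} (hg : Measurable g) :
    Measurable fun c : Measure E => ∫ x, g x ∂c := by
  classical
  have h : (fun c : Measure E => ∫ x, g x ∂c) = fun c =>
      if Integrable g c then ((∫ x, (g x).re ∂c : ℝ) : ℂ) + ((∫ x, (g x).im ∂c : ℝ) : ℂ) * Complex.I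
        else 0 := by
    ext c
    split_ifs with hc
    · exact (integral_re_add_im hc).symm
    · exact integral_undef hc
  rw [h]
  have h1 := measurable_integral_measure (Complex.measurable_re.comp hg)
  have h2 := measurable_integral_measure (Complex.measurable_im.comp hg)
  refine Measurable.ite (measurableSet_integrable hg) ?_ measurable_const
  exact (Complex.measurable_ofReal.comp h1).add
    ((Complex.measurable_ofReal.comp h2).mul measurable_const)

/-! ### The exponential function on the left half-plane -/

lemma norm_exp_sub_exp_le {a b : ℂ} (ha : a.re ≤ 0) (hb : b.re ≤ 0) :
    ‖Complex.exp a - Complex.exp b‖ ≤ ‖a - b‖ := by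
  have := (convex_halfSpace_re_le (0 : ℝ)).norm_image_sub_le_of_norm_hasDerivWithin_le
    (f := Complex.exp) (f' := Complex.exp) (C := 1) (x := b) (y := a)
    (fun x _ => (Complex.hasDerivAt_exp x).hasDerivWithinAt)
    (fun x hx => by simpa [Complex.norm_exp] using hx) hb ha
  simpa using this

lemma norm_exp_sub_one_le_norm {a : ℂ} (ha : a.re ≤ 0) : ‖Complex.exp a - 1‖ ≤ ‖a‖ := by
  simpa using norm_exp_sub_exp_le ha (b := 0) (by simp)

lemma norm_exp_le_one {a : ℂ} (ha : a.re ≤ 0) : ‖Complex.exp a‖ ≤ 1 := by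
  simpa [Complex.norm_exp] using ha

/-! ### The Poisson distribution -/

lemma lintegral_natCast_poissonMeasure (r : ℝ≥0) :
    ∫⁻ n, (n : ℝ≥0∞) ∂(poissonMeasure r) = r := by
  rw [poissonMeasure, lintegral_sum_measure]
  simp only [lintegral_smul_measure, lintegral_dirac, smul_eq_mul]
  rw [tsum_eq_zero_add' ENNReal.summable]
  have h1 : ∀ n : ℕ, ENNReal.ofReal (Real.exp (-r) * r ^ (n + 1) / (n + 1).factorial) *
      ((n + 1 : ℕ) : ℝ≥0∞) = r * ENNReal.ofReal (Real.exp (-r) * r ^ n / n.factorial) := by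
    intro n
    rw [← ENNReal.ofReal_natCast, ← ENNReal.ofReal_coe_nnreal, ← ENNReal.ofReal_mul (by positivity),
      ← ENNReal.ofReal_mul (by positivity)]
    congr 1
    rw [Nat.factorial_succ]
    push_cast
    have : (n.factorial : ℝ) ≠ 0 := by positivity
    field_simp
    ring
  have h2 := hasSum_one_poissonMeasure r
  simp only [h1, Nat.cast_zero, mul_zero, zero_add]
  rw [ENNReal.tsum_mul_left, ← ENNReal.ofReal_tsum_of_nonneg (fun n => by positivity) h2.summable,
    h2.tsum_eq]
  simp

lemma integral_exp_mul_poissonMeasure (r : ℝ≥0) (c : ℂ) :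
    ∫ n, Complex.exp (c * n) ∂(poissonMeasure r) = Complex.exp (r * (Complex.exp c - 1)) := by
  rw [integral_poissonMeasure r]
  calc ∑' a : ℕ, (Real.exp (-r) * r ^ a / a.factorial : ℝ) • Complex.exp (c * a)
  _ = ∑' a : ℕ, (Real.exp (-r) : ℂ) * ((r * Complex.exp c) ^ a / a.factorial) := by
      congr with a
      rw [Complex.real_smul]
      push_cast
      rw [mul_pow, ← Complex.exp_nat_mul]
      ring_nf
  _ = (Real.exp (-r)) * ∑' a : ℕ, ((r * Complex.exp c) ^ a / a.factorial : ℂ) := tsum_mul_left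
  _ = (Real.exp (-r)) * Complex.exp (r * Complex.exp c) := by
      rw [(NormedSpace.expSeries_div_hasSum_exp (r * Complex.exp c)).tsum_eq,
        Complex.exp_eq_exp_ℂ]
  _ = Complex.exp (r * (Complex.exp c - 1)) := by
      rw [Complex.ofReal_exp, ← Complex.exp_add]
      push_cast
      ring_nf

/-! ### Campbell's formula and the exponential functional of a Poisson process -/

variable [TopologicalSpace E] {N : Ω → Measure E} {ν : Measure E} {P : Measure Ω}

lemma IsPoissonProcess.measurable (hN : IsPoissonProcess N ν P) : Measurable N :=
  hN.isPointProcess.measurable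

lemma IsPoissonProcess.lintegral_apply (h : IsPoissonProcess N ν P) {A : Set E}
    (hA : MeasurableSet A) (hνA : ν A < ∞) : ∫⁻ ω, N ω A ∂P = ν A := by
  have := (h.law A hA hνA).lintegral_comp (f := fun x => x) aemeasurable_id
  rw [this, lintegral_map measurable_id' (by fun_prop), lintegral_natCast_poissonMeasure,
    ENNReal.coe_toNNReal hνA.ne]

/-- The intensity measure of a Poisson process is its mean measure. -/
lemma IsPoissonProcess.bind_eq (h : IsPoissonProcess N ν P) : P.bind N = ν := by
  have := h.sigmaFinite
  refine (Measure.ext_iff_of_iUnion_eq_univ (iUnion_spanningSets ν)).2 fun i => ?_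
  ext A hA
  have hAi : MeasurableSet (A ∩ spanningSets ν i) := hA.inter (measurableSet_spanningSets ν i)
  rw [Measure.restrict_apply hA, Measure.restrict_apply hA,
    Measure.bind_apply hAi h.measurable.aemeasurable]
  exact h.lintegral_apply hAi
    ((measure_mono Set.inter_subset_right).trans_lt (measure_spanningSets_lt_top ν i))

/-- **Campbell's formula**. -/
lemma IsPoissonProcess.lintegral_lintegral (h : IsPoissonProcess N ν P) {f : E → ℝ≥0∞}
    (hf : Measurable f) : ∫⁻ ω, ∫⁻ x, f x ∂(N ω) ∂P = ∫⁻ x, f x ∂ν := by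
  rw [← h.bind_eq,
    Measure.lintegral_bind h.measurable.aemeasurable hf.aemeasurable]

lemma IsPoissonProcess.ae_integrable {F : Type*} [NormedAddCommGroup F] [MeasurableSpace F]
    [BorelSpace F] [SecondCountableTopology F] (h : IsPoissonProcess N ν P) {g : E → F}
    (hg : Measurable g) (hgi : Integrable g ν) : ∀ᵐ ω ∂P, Integrable g (N ω) := by
  have h1 : ∫⁻ ω, ∫⁻ x, ‖g x‖ₑ ∂(N ω) ∂P ≠ ∞ := by
    rw [h.lintegral_lintegral hg.enorm]
    exact hgi.2.ne
  filter_upwards [ae_lt_top ((Measure.measurable_lintegral hg.enorm).comp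
    h.measurable) h1] with ω hω
  exact ⟨hg.aestronglyMeasurable, hω⟩

lemma IsPoissonProcess.ae_sFinite (hN : IsPoissonProcess N ν P) : ∀ᵐ ω ∂P, SFinite (N ω) := by
  filter_upwards [hN.isPointProcess.counting] with ω ⟨s, x, hx⟩
  rw [hx]
  infer_instance

/-- Signed form of Campbell's formula. -/
lemma IsPoissonProcess.integral_integral (h : IsPoissonProcess N ν P) {g : E → ℝ}
    (hg : Measurable g) (hgi : Integrable g ν) :
    ∫ ω, ∫ x, g x ∂(N ω) ∂P = ∫ x, g x ∂ν := by
  have hm := h.measurable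
  have key : ∀ u : E → ℝ, Measurable u → Integrable u ν →
      Integrable (fun ω => (∫⁻ x, ENNReal.ofReal (u x) ∂(N ω)).toReal) P ∧
      ∫ ω, (∫⁻ x, ENNReal.ofReal (u x) ∂(N ω)).toReal ∂P =
        (∫⁻ x, ENNReal.ofReal (u x) ∂ν).toReal := by
    intro u hu hui
    have h1 : ∫⁻ ω, ∫⁻ x, ENNReal.ofReal (u x) ∂(N ω) ∂P ≠ ∞ := by
      rw [h.lintegral_lintegral hu.ennreal_ofReal]
      exact hui.lintegral_lt_top.ne
    have h2 : Measurable fun ω => ∫⁻ x, ENNReal.ofReal (u x) ∂(N ω) :=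
      (Measure.measurable_lintegral hu.ennreal_ofReal).comp hm
    refine ⟨integrable_toReal_of_lintegral_ne_top h2.aemeasurable h1, ?_⟩
    rw [integral_toReal h2.aemeasurable (ae_lt_top h2 h1),
      h.lintegral_lintegral hu.ennreal_ofReal]
  obtain ⟨i1, e1⟩ := key g hg hgi
  obtain ⟨i2, e2⟩ := key (fun x => -g x) hg.neg hgi.neg
  rw [integral_eq_lintegral_pos_part_sub_lintegral_neg_part hgi, ← e1, ← e2, ← integral_sub i1 i2]
  refine integral_congr_ae ?_
  filter_upwards [h.ae_integrable hg hgi] with ω hω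
  exact integral_eq_lintegral_pos_part_sub_lintegral_neg_part hω

lemma IsPoissonProcess.iIndepFun_finset {ι : Type*} [Fintype ι] (h : IsPoissonProcess N ν P)
    (A : ι → Set E) (hA : ∀ i, MeasurableSet (A i)) (hd : ∀ i j, i ≠ j → Disjoint (A i) (A j)) :
    iIndepFun (fun i ω => N ω (A i)) P := by
  let e := Fintype.equivFin ι
  have := h.indep (Fintype.card ι) (fun i => A (e.symm i)) (fun i => hA _)
    (fun i j hij => hd _ _ (e.symm.injective.ne hij))
  simpa [Function.comp_def] using this.precomp (g := e) e.injective

lemma IsPoissonProcess.integral_exp_mul (h : IsPoissonProcess N ν P) {A : Set E}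
    (hA : MeasurableSet A) (hνA : ν A < ∞) (c : ℂ) :
    ∫ ω, Complex.exp (c * (N ω).real A) ∂P = Complex.exp (ν.real A * (Complex.exp c - 1)) := by
  have := (h.law A hA hνA).integral_comp (f := fun x : ℝ≥0∞ => Complex.exp (c * x.toReal))
    (by fun_prop)
  simp only [Measure.real]
  simp only [Function.comp_def] at this
  rw [this, integral_map (by fun_prop) (by fun_prop)]
  simp only [ENNReal.toReal_natCast, Complex.ofReal_natCast]
  exact integral_exp_mul_poissonMeasure (ν A).toNNReal c

/-- The counts of the level sets of `w` are independent Poisson variables; the level set of `0`, of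
possibly infinite intensity, contributes the factor `1`. -/
lemma IsPoissonProcess.integral_exp_simpleFunc (h : IsPoissonProcess N ν P) (w : SimpleFunc E ℂ)
    (hw : Integrable w ν) :
    ∫ ω, Complex.exp (∫ x, w x ∂(N ω)) ∂P = Complex.exp (∫ x, (Complex.exp (w x) - 1) ∂ν) := by
  have hA (z : ℂ) : MeasurableSet (w ⁻¹' {z}) := w.measurableSet_fiber z
  have e1 : ∫ x, (Complex.exp (w x) - 1) ∂ν =
      ∑ z ∈ w.range, ν.real (w ⁻¹' {z}) • (Complex.exp z - 1) := by
    have h1 := w.map_integral (μ := ν) (fun z => Complex.exp z - 1) hw (by simp)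
    rw [← h1, SimpleFunc.integral_eq_integral]
    · rfl
    · exact SimpleFunc.integrable_iff_finMeasSupp.2
        ((SimpleFunc.integrable_iff_finMeasSupp.1 hw).map (by simp))
  have e2 : ∀ᵐ ω ∂P, Complex.exp (∫ x, w x ∂(N ω)) =
      ∏ z : w.range, Complex.exp (z * (N ω).real (w ⁻¹' {z.1})) := by
    filter_upwards [h.ae_integrable w.measurable hw] with ω hω
    rw [← SimpleFunc.integral_eq_integral w hω, SimpleFunc.integral_eq, Complex.exp_sum,
      ← Finset.prod_coe_sort]
    refine Finset.prod_congr rfl fun z _ => ?_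
    rw [Complex.real_smul, mul_comm]
  have hm := h.measurable
  have hind := h.iIndepFun_finset (fun z : w.range => w ⁻¹' {z.1}) (fun z => hA _) fun i j hij => by
    rw [Set.disjoint_left]
    intro x hx hx'
    exact hij (Subtype.ext ((Set.mem_singleton_iff.1 hx).symm.trans hx'))
  rw [integral_congr_ae e2, e1, Complex.exp_sum, ← Finset.prod_coe_sort]
  have := hind.integral_fun_prod_comp
    (f := fun (z : w.range) (t : ℝ≥0∞) => Complex.exp (z * (t.toReal : ℂ)))
    (fun z => ((Measure.measurable_coe (hA z.1)).comp hm).aemeasurable) (fun z => by fun_prop)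
  simp only [Measure.real] at this ⊢
  rw [this]
  refine Finset.prod_congr rfl fun z _ => ?_
  by_cases hz : z.1 = 0
  · have hP : IsProbabilityMeasure P := hind.isProbabilityMeasure
    simp [hz]
  · have := h.integral_exp_mul (hA z.1)
      (SimpleFunc.measure_preimage_lt_top_of_integrable w hw hz) z.1
    simp only [Measure.real] at this
    rw [this, Complex.real_smul]

/-- The exponential functional of a Poisson process, for a complex integrand with non-positive real
part. It follows from the case of simple functions by approximation in `L¹(ν)`: on the left
half-plane the exponential is a contraction, so that by Campbell's formula both sides are
`1`-Lipschitz for the `L¹(ν)` distance. -/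
theorem IsPoissonProcess.integral_exp_integral [IsProbabilityMeasure P]
    (h : IsPoissonProcess N ν P) {w : E → ℂ}
    (hw : Measurable w) (hwi : Integrable w ν) (hre : ∀ x, (w x).re ≤ 0) :
    ∫ ω, Complex.exp (∫ x, w x ∂(N ω)) ∂P = Complex.exp (∫ x, (Complex.exp (w x) - 1) ∂ν) := by
  have hm := h.measurable
  have re_int : ∀ (u : E → ℂ) (m : Measure E), (∀ x, (u x).re ≤ 0) → (∫ x, u x ∂m).re ≤ 0 := by
    intro u m hu
    by_cases hui : Integrable u m
    · have := integral_re hui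
      simp only [RCLike.re_eq_complex_re] at this
      rw [← this]
      exact integral_nonpos hu
    · simp [integral_undef hui]
  set s : Set ℂ := {z | z.re ≤ 0} with hs
  have h0 : (0 : ℂ) ∈ s := by simp [hs]
  let a : ℕ → SimpleFunc E ℂ := fun n => SimpleFunc.approxOn w hw s 0 h0 n
  have ha_re : ∀ n x, (a n x).re ≤ 0 := fun n x => SimpleFunc.approxOn_mem hw h0 n x
  have ha_int : ∀ n, Integrable (a n) ν := fun n =>
    SimpleFunc.integrable_approxOn hw hwi h0 (by simp) n
  have hlim : Tendsto (fun n => ∫⁻ x, ‖a n x - w x‖ₑ ∂ν) atTop (𝓝 0) :=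
    SimpleFunc.tendsto_approxOn_L1_enorm hw h0
      (ae_of_all _ fun x => subset_closure (hre x)) (by simpa using hwi.2)
  have hmeas : ∀ u : E → ℂ, Measurable u →
      Measurable fun ω => Complex.exp (∫ x, u x ∂(N ω)) := fun u hu =>
    Complex.measurable_exp.comp ((measurable_integral_measure_complex hu).comp hm)
  have hint : ∀ u : E → ℂ, Measurable u → (∀ x, (u x).re ≤ 0) →
      Integrable (fun ω => Complex.exp (∫ x, u x ∂(N ω))) P := fun u hu hu' =>
    Integrable.of_bound (hmeas u hu).aestronglyMeasurable 1
      (ae_of_all _ fun ω => norm_exp_le_one (re_int u _ hu'))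
  have hint2 : ∀ u : E → ℂ, Measurable u → Integrable u ν → (∀ x, (u x).re ≤ 0) →
      Integrable (fun x => Complex.exp (u x) - 1) ν := fun u hu hui hu' =>
    hui.mono ((Complex.measurable_exp.comp hu).sub_const 1).aestronglyMeasurable
      (ae_of_all _ fun x => norm_exp_sub_one_le_norm (hu' x))
  have lim1 : Tendsto (fun n => ∫ ω, Complex.exp (∫ x, a n x ∂(N ω)) ∂P) atTop
      (𝓝 (∫ ω, Complex.exp (∫ x, w x ∂(N ω)) ∂P)) := by
    refine tendsto_integral_of_L1 _ (hint w hw hre).aestronglyMeasurable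
      (Eventually.of_forall fun n => hint _ (a n).measurable (ha_re n)) ?_
    refine tendsto_of_tendsto_of_tendsto_of_le_of_le tendsto_const_nhds hlim
      (fun _ => zero_le) fun n => ?_
    have hd : Measurable fun x => a n x - w x := (a n).measurable.sub hw
    simp only
    rw [← h.lintegral_lintegral hd.enorm]
    refine lintegral_mono_ae ?_
    filter_upwards [h.ae_integrable hw hwi, h.ae_integrable (a n).measurable (ha_int n)]
      with ω h1 h2
    calc ‖Complex.exp (∫ x, a n x ∂(N ω)) - Complex.exp (∫ x, w x ∂(N ω))‖ₑ
        ≤ ‖(∫ x, a n x ∂(N ω)) - ∫ x, w x ∂(N ω)‖ₑ := by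
          rw [enorm_le_iff_norm_le]
          exact norm_exp_sub_exp_le (re_int _ _ (ha_re n)) (re_int _ _ hre)
      _ = ‖∫ x, (a n x - w x) ∂(N ω)‖ₑ := by rw [integral_sub h2 h1]
      _ ≤ _ := enorm_integral_le_lintegral_enorm _
  have lim2 : Tendsto (fun n => ∫ x, (Complex.exp (a n x) - 1) ∂ν) atTop
      (𝓝 (∫ x, (Complex.exp (w x) - 1) ∂ν)) := by
    refine tendsto_integral_of_L1 _ (hint2 w hw hwi hre).aestronglyMeasurable
      (Eventually.of_forall fun n => hint2 _ (a n).measurable (ha_int n) (ha_re n)) ?_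
    refine tendsto_of_tendsto_of_tendsto_of_le_of_le tendsto_const_nhds hlim
      (fun _ => zero_le) fun n => lintegral_mono fun x => ?_
    rw [enorm_le_iff_norm_le, sub_sub_sub_cancel_right]
    exact norm_exp_sub_exp_le (ha_re n x) (hre x)
  refine tendsto_nhds_unique lim1 ?_
  simp only [h.integral_exp_simpleFunc _ (ha_int _)]
  exact (Complex.continuous_exp.tendsto _).comp lim2

end PointProcess

/-! ### Cox processes -/

section Cox

variable {Ω E : Type*} [MeasurableSpace Ω] [MeasurableSpace E]
  {C Λ : Ω → Measure E} {P : Measure Ω} {g : E → ℝ}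

lemma integrable_integral_measure {M : Ω → Measure E} (hM : Measurable M) (hg : Measurable g)
    (hgi : ∫⁻ ω, ∫⁻ x, ‖g x‖ₑ ∂(M ω) ∂P ≠ ∞) : Integrable (fun ω => ∫ x, g x ∂(M ω)) P := by
  refine ⟨((measurable_integral_measure hg).comp hM).aestronglyMeasurable, ?_⟩
  exact (lintegral_mono fun ω => enorm_integral_le_lintegral_enorm _).trans_lt hgi.lt_top

lemma ae_integrable_of_lintegral_ne_top {M : Ω → Measure E} (hM : Measurable M) (hg : Measurable g)
    (hgi : ∫⁻ ω, ∫⁻ x, ‖g x‖ₑ ∂(M ω) ∂P ≠ ∞) : ∀ᵐ ω ∂P, Integrable g (M ω) := by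
  filter_upwards [ae_lt_top ((Measure.measurable_lintegral hg.enorm).comp hM) hgi] with ω hω
  exact ⟨hg.aestronglyMeasurable, hω⟩

lemma IsCoxProcess.measurable [TopologicalSpace E] (hC : IsCoxProcess C Λ P) : Measurable C :=
  hC.isPointProcess.measurable

variable [IsProbabilityMeasure P]

/-- The law of the pair `(Λ, C)` is disintegrated over the values of `Λ`. -/
lemma lintegral_condDistrib {K : Kernel (Measure E) (Measure E)} [IsMarkovKernel K]
    (hΛ : Measurable Λ) (hK : HasCondDistrib C Λ K P) {F : Measure E × Measure E → ℝ≥0∞}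
    (hF : Measurable F) : ∫⁻ ω, F (Λ ω, C ω) ∂P = ∫⁻ ω, ∫⁻ c, F (Λ ω, c) ∂(K (Λ ω)) ∂P := by
  have : IsProbabilityMeasure (P.map Λ) := Measure.isProbabilityMeasure_map hΛ.aemeasurable
  have h1 := HasLaw.lintegral_comp hK hF.aemeasurable
  rw [h1, Measure.lintegral_compProd hF, lintegral_map hF.lintegral_kernel_prod_right' hΛ]

lemma integral_condDistrib {F' : Type*} [NormedAddCommGroup F'] [NormedSpace ℝ F']
    {K : Kernel (Measure E) (Measure E)} [IsMarkovKernel K]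
    (hΛ : Measurable Λ) (hK : HasCondDistrib C Λ K P) {F : Measure E × Measure E → F'}
    (hF : StronglyMeasurable F) (hFi : Integrable (fun ω => F (Λ ω, C ω)) P) :
    ∫ ω, F (Λ ω, C ω) ∂P = ∫ ω, ∫ c, F (Λ ω, c) ∂(K (Λ ω)) ∂P := by
  have : IsProbabilityMeasure (P.map Λ) := Measure.isProbabilityMeasure_map hΛ.aemeasurable
  have h1 := HasLaw.integral_comp hK hF.aestronglyMeasurable
  have h2 : Integrable F ((P.map Λ) ⊗ₘ K) := by
    rw [← hK.map_eq]
    exact (integrable_map_measure hF.aestronglyMeasurable hK.aemeasurable).2 hFi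
  simp only [Function.comp_def] at h1
  rw [h1, Measure.integral_compProd h2, integral_map hΛ.aemeasurable]
  exact hF.integral_kernel_prod_right'.aestronglyMeasurable

variable [TopologicalSpace E]

/-- The mean measure of a Cox process is that of its directing measure. -/
lemma IsCoxProcess.lintegral_lintegral (h : IsCoxProcess C Λ P) {f : E → ℝ≥0∞}
    (hf : Measurable f) :
    ∫⁻ ω, ∫⁻ x, f x ∂(C ω) ∂P = ∫⁻ ω, ∫⁻ x, f x ∂(Λ ω) ∂P := by
  obtain ⟨K, _, hK, hpois⟩ := h.conditionally_poisson
  have hΛ := h.measurable_directing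
  rw [lintegral_condDistrib hΛ hK (F := fun p => ∫⁻ x, f x ∂p.2)
    ((Measure.measurable_lintegral hf).comp measurable_snd)]
  refine lintegral_congr_ae ?_
  filter_upwards [ae_of_ae_map hΛ.aemeasurable hpois] with ω hω
  exact hω.lintegral_lintegral hf

lemma IsCoxProcess.ae_integrable (h : IsCoxProcess C Λ P) (hg : Measurable g)
    (hgi : ∫⁻ ω, ∫⁻ x, ‖g x‖ₑ ∂(Λ ω) ∂P ≠ ∞) : ∀ᵐ ω ∂P, Integrable g (C ω) := by
  rw [← h.lintegral_lintegral hg.enorm] at hgi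
  exact ae_integrable_of_lintegral_ne_top h.measurable hg hgi

lemma IsCoxProcess.integrable_integral (h : IsCoxProcess C Λ P) (hg : Measurable g)
    (hgi : ∫⁻ ω, ∫⁻ x, ‖g x‖ₑ ∂(Λ ω) ∂P ≠ ∞) : Integrable (fun ω => ∫ x, g x ∂(C ω)) P :=
  integrable_integral_measure h.measurable hg (by
    rwa [h.lintegral_lintegral hg.enorm])

/-- Conditional form of Campbell's formula. -/
theorem IsCoxProcess.condExp_integral (h : IsCoxProcess C Λ P) (hg : Measurable g)
    (hgi : ∫⁻ ω, ∫⁻ x, ‖g x‖ₑ ∂(Λ ω) ∂P ≠ ∞) :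
    P[fun ω => ∫ x, g x ∂(C ω) | MeasurableSpace.comap Λ inferInstance] =ᵐ[P]
      fun ω => ∫ x, g x ∂(Λ ω) := by
  obtain ⟨K, _, hK, hpois⟩ := h.conditionally_poisson
  have hΛ := h.measurable_directing
  have hmg := measurable_integral_measure hg
  have hiC := h.integrable_integral hg hgi
  have hiΛ : Integrable (fun ω => ∫ x, g x ∂(Λ ω)) P := integrable_integral_measure hΛ hg hgi
  refine (ae_eq_condExp_of_forall_setIntegral_eq hΛ.comap_le hiC
    (fun s _ _ => hiΛ.integrableOn) ?_ ?_).symm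
  · rintro s ⟨t, ht, rfl⟩ _
    have hF : Measurable fun p : Measure E × Measure E =>
        t.indicator (fun _ => ∫ x, g x ∂p.2) p.1 :=
      Measurable.ite (measurable_fst ht) (hmg.comp measurable_snd) measurable_const
    have hFi : Integrable (fun ω => t.indicator (fun _ => ∫ x, g x ∂(C ω)) (Λ ω)) P :=
      hiC.indicator (hΛ ht)
    have key := integral_condDistrib hΛ hK hF.stronglyMeasurable hFi
    rw [← integral_indicator (hΛ ht), ← integral_indicator (hΛ ht)]
    refine Eq.trans ?_ key.symm
    refine integral_congr_ae ?_
    filter_upwards [ae_of_ae_map hΛ.aemeasurable hpois, ae_integrable_of_lintegral_ne_top hΛ hg hgi]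
      with ω hω hi
    by_cases hωt : Λ ω ∈ t
    · simp only [Set.indicator, Set.mem_preimage, hωt, if_true]
      exact (hω.integral_integral hg hi).symm
    · simp [Set.indicator, hωt]
  · exact (hmg.comp (comap_measurable Λ)).aestronglyMeasurable

/-- The characteristic functional of a Cox process centred by its directing measure: conditionally
on `Λ` this is the compensated exponential functional of a Poisson process. -/
theorem IsCoxProcess.integral_exp_centred (h : IsCoxProcess C Λ P) (hg : Measurable g)
    (hgi : ∫⁻ ω, ∫⁻ x, ‖g x‖ₑ ∂(Λ ω) ∂P ≠ ∞) :
    ∫ ω, Complex.exp (Complex.I * ((∫ x, g x ∂(C ω) - ∫ x, g x ∂(Λ ω) : ℝ) : ℂ)) ∂P =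
      ∫ ω, Complex.exp (∫ x, psi (g x) ∂(Λ ω)) ∂P := by
  obtain ⟨K, _, hK, hpois⟩ := h.conditionally_poisson
  have hΛ := h.measurable_directing
  have hmg := measurable_integral_measure hg
  have hF : Measurable fun p : Measure E × Measure E =>
      Complex.exp (Complex.I * ((∫ x, g x ∂p.2 - ∫ x, g x ∂p.1 : ℝ) : ℂ)) := by fun_prop
  have hFi : Integrable (fun ω =>
      Complex.exp (Complex.I * ((∫ x, g x ∂(C ω) - ∫ x, g x ∂(Λ ω) : ℝ) : ℂ))) P := by
    refine Integrable.of_bound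
      (hF.comp (hΛ.prodMk h.measurable)).aestronglyMeasurable 1
      (ae_of_all _ fun ω => norm_exp_le_one (by simp))
  rw [integral_condDistrib hΛ hK hF.stronglyMeasurable hFi]
  refine integral_congr_ae ?_
  filter_upwards [ae_of_ae_map hΛ.aemeasurable hpois, ae_integrable_of_lintegral_ne_top hΛ hg hgi]
    with ω hω hi
  have hw : Measurable fun x => Complex.I * (g x : ℂ) := by fun_prop
  have hwi : Integrable (fun x => Complex.I * (g x : ℂ)) (Λ ω) := hi.ofReal.const_mul _
  have hexp : Integrable (fun x => Complex.exp (Complex.I * (g x : ℂ)) - 1) (Λ ω) :=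
    hwi.mono (by fun_prop) (ae_of_all _ fun x => norm_exp_sub_one_le_norm (by simp))
  have hP := hω.integral_exp_integral hw hwi (by simp)
  have e1 (c : Measure E) : Complex.exp (Complex.I * ((∫ x, g x ∂c - ∫ x, g x ∂(Λ ω) : ℝ) : ℂ)) =
      Complex.exp (∫ x, Complex.I * (g x : ℂ) ∂c) *
        Complex.exp (-∫ x, Complex.I * (g x : ℂ) ∂(Λ ω)) := by
    rw [← Complex.exp_add, integral_const_mul, integral_const_mul, integral_complex_ofReal,
      integral_complex_ofReal]
    push_cast
    ring_nf
  simp only [e1, integral_mul_const]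
  rw [hP, ← Complex.exp_add, ← sub_eq_add_neg, ← integral_sub hexp hwi]
  rfl

end Cox

/-! ### The function `ψ` -/

section Psi

lemma measurable_psi : Measurable psi := by unfold psi; fun_prop

lemma norm_psi_le (x : ℝ) : ‖psi x‖ ≤ 2 * ‖x‖ := by
  have h1 : ‖Complex.exp (Complex.I * x) - 1‖ ≤ ‖x‖ := Real.norm_exp_I_mul_ofReal_sub_one_le
  calc ‖psi x‖ ≤ ‖Complex.exp (Complex.I * x) - 1‖ + ‖Complex.I * (x : ℂ)‖ := norm_sub_le _ _
    _ ≤ 2 * ‖x‖ := by simp only [norm_mul, Complex.norm_I, Complex.norm_real]; linarith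

lemma psi_re_nonpos (x : ℝ) : (psi x).re ≤ 0 := by
  have h : (psi x).re = Real.cos x - 1 := by
    simp [psi, mul_comm Complex.I, Complex.exp_ofReal_mul_I_re]
  rw [h]
  linarith [Real.cos_le_one x]

lemma integrable_psi_comp {E : Type*} [MeasurableSpace E] {m : Measure E} {g : E → ℝ}
    (hg : Measurable g) (hgi : Integrable g m) : Integrable (fun x => psi (g x)) m :=
  (hgi.norm.const_mul 2).mono' (measurable_psi.comp hg).aestronglyMeasurable
    (ae_of_all _ fun x => norm_psi_le (g x))

lemma integral_psi_re_nonpos {E : Type*} [MeasurableSpace E] {m : Measure E} (g : E → ℝ) :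
    (∫ x, psi (g x) ∂m).re ≤ 0 := by
  by_cases hui : Integrable (fun x => psi (g x)) m
  · have := integral_re hui
    simp only [RCLike.re_eq_complex_re] at this
    rw [← this]
    exact integral_nonpos fun x => psi_re_nonpos (g x)
  · simp [integral_undef hui]

end Psi

/-! ### Integrability of the weighted mass -/

section WeightedMass

variable {d : ℕ}

lemma measurableSet_setOf_mem_closedBall :
    MeasurableSet {q : (Space d × ℝ) × Space d | q.2 ∈ Metric.closedBall q.1.1 q.1.2} := by
  simp only [Metric.mem_closedBall]
  exact measurableSet_le (by fun_prop) (by fun_prop)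

lemma measurable_signedMeasure_closedBall (μ : SignedMeasure (Space d)) :
    Measurable fun p : Space d × ℝ => μ (Metric.closedBall p.1 p.2) := by
  have h (m : Measure (Space d)) [IsFiniteMeasure m] :
      Measurable fun p : Space d × ℝ => m.real (Metric.closedBall p.1 p.2) :=
    (measurable_measure_prodMk_left measurableSet_setOf_mem_closedBall).ennreal_toReal
  simp only [μ.apply_eq_posPart_real_sub_negPart_real Metric.isClosed_closedBall.measurableSet]
  exact (h _).sub (h _)

lemma measurable_weightedMass (μ : SignedMeasure (Space d)) : Measurable (weightedMass μ) := by
  have h := (measurable_signedMeasure_closedBall μ).comp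
    (measurable_fst.prodMk (measurable_fst.comp measurable_snd) :
      Measurable fun z : Marked d => (z.1, z.2.1))
  exact (measurable_snd.comp measurable_snd).mul h

/-- The volume of the centers of the balls of radius `r` that contain a given point is that of a
ball of radius `r`. -/
lemma lintegral_enorm_signedMeasure_closedBall_le (μ : SignedMeasure (Space d)) {r : ℝ}
    (hr : 0 ≤ r) :
    ∫⁻ x, ‖μ (Metric.closedBall x r)‖ₑ ≤
      μ.totalVariation Set.univ * volume (Metric.closedBall (0 : Space d) 1) *
        ENNReal.ofReal (r ^ d) := by
  have hm : Measurable fun p : Space d × Space d =>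
      (Metric.closedBall p.1 r).indicator (1 : Space d → ℝ≥0∞) p.2 := by
    refine Measurable.ite ?_ measurable_const measurable_const
    exact measurableSet_le (f := fun p : Space d × Space d => dist p.2 p.1) (by fun_prop)
      (by fun_prop)
  calc ∫⁻ x, ‖μ (Metric.closedBall x r)‖ₑ
      ≤ ∫⁻ x, μ.totalVariation (Metric.closedBall x r) :=
        lintegral_mono fun x => μ.enorm_le_totalVariation _
    _ = ∫⁻ x, ∫⁻ y, (Metric.closedBall x r).indicator 1 y ∂μ.totalVariation := by
        simp only [lintegral_indicator_one Metric.isClosed_closedBall.measurableSet]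
    _ = ∫⁻ y, (∫⁻ x, (Metric.closedBall x r).indicator 1 y) ∂μ.totalVariation :=
        lintegral_lintegral_swap hm.aemeasurable
    _ = ∫⁻ _, volume (Metric.closedBall (0 : Space d) 1) * ENNReal.ofReal (r ^ d)
          ∂μ.totalVariation := by
        refine lintegral_congr fun y => ?_
        have : (fun x => (Metric.closedBall x r).indicator (1 : Space d → ℝ≥0∞) y) =
            (Metric.closedBall y r).indicator 1 := by
          ext x
          simp only [Set.indicator, Metric.mem_closedBall, dist_comm, Pi.one_apply]
        rw [this, lintegral_indicator_one Metric.isClosed_closedBall.measurableSet,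
          Measure.addHaar_closedBall' _ _ hr, mul_comm]
        simp
    _ = _ := by rw [lintegral_const]; ring

variable {f : ℝ → ℝ} {G : Measure ℝ} {ρ : ℝ}

instance : SFinite (radiusMeasure f ρ) := by unfold radiusMeasure; infer_instance

/-- The tail bound with `β > d` gives the radii a moment of order `d`. -/
lemma integrableOn_pow_mul {β C₀ : ℝ} (hβ : (d : ℝ) < β) (hf_meas : Measurable f)
    (hf_nonneg : ∀ r, 0 < r → 0 ≤ f r) (hf_int : IntegrableOn f (Set.Ioi 0))
    (hf_le : ∀ r, 0 < r → f r ≤ C₀ / r ^ (β + 1)) :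
    IntegrableOn (fun r => r ^ d * f r) (Set.Ioi 0) := by
  have hm : Measurable fun r => r ^ d * f r := by fun_prop
  rw [← Set.Ioc_union_Ioi_eq_Ioi zero_le_one, integrableOn_union]
  constructor
  · refine Integrable.mono' (hf_int.mono_set Set.Ioc_subset_Ioi_self) hm.aestronglyMeasurable ?_
    filter_upwards [ae_restrict_mem measurableSet_Ioc] with r hr
    rw [norm_mul, Real.norm_of_nonneg (hf_nonneg r hr.1),
      Real.norm_of_nonneg (pow_nonneg hr.1.le d)]
    exact mul_le_of_le_one_left (hf_nonneg r hr.1) (pow_le_one₀ hr.1.le hr.2)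
  · have hi : IntegrableOn (fun r : ℝ => C₀ * r ^ (d - β - 1 : ℝ)) (Set.Ioi 1) :=
      (integrableOn_Ioi_rpow_of_lt (by linarith) one_pos).const_mul C₀
    refine Integrable.mono' hi hm.aestronglyMeasurable ?_
    filter_upwards [ae_restrict_mem measurableSet_Ioi] with r hr
    have hr0 : 0 < r := zero_lt_one.trans hr
    rw [norm_mul, Real.norm_of_nonneg (hf_nonneg r hr0), Real.norm_of_nonneg (by positivity)]
    calc r ^ d * f r ≤ r ^ d * (C₀ / r ^ (β + 1)) := by
          gcongr
          exact hf_le r hr0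
      _ = C₀ * r ^ (d - β - 1 : ℝ) := by
          rw [sub_sub, Real.rpow_sub hr0, Real.rpow_natCast]
          ring

lemma lintegral_pow_radiusMeasure_ne_top {β C₀ : ℝ} (hβ : (d : ℝ) < β) (hf_meas : Measurable f)
    (hf_nonneg : ∀ r, 0 < r → 0 ≤ f r) (hf_int : IntegrableOn f (Set.Ioi 0))
    (hf_le : ∀ r, 0 < r → f r ≤ C₀ / r ^ (β + 1)) (hρ : 0 < ρ) :
    ∫⁻ r, ENNReal.ofReal (r ^ d) ∂(radiusMeasure f ρ) ≠ ∞ := by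
  have h1 := (integrableOn_Ioi_comp_mul_left_iff (fun r => r ^ d * f r) 0 (inv_pos.2 hρ)).2
    (by simpa using integrableOn_pow_mul hβ hf_meas hf_nonneg hf_int hf_le)
  have h2 := h1.const_mul (ρ ^ d / ρ)
  rw [radiusMeasure, lintegral_withDensity_eq_lintegral_mul _ (by fun_prop) (by fun_prop)]
  refine ne_of_eq_of_ne (setLIntegral_congr_fun measurableSet_Ioi fun r hr => ?_)
    h2.lintegral_lt_top.ne
  have hr : 0 < r := hr
  have hf := hf_nonneg (r / ρ) (by positivity)
  simp only [Pi.mul_apply]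
  rw [← ENNReal.ofReal_mul (by positivity), ← div_eq_inv_mul, div_pow]
  congr 1
  field_simp

variable [IsProbabilityMeasure G]

lemma ae_radiusMeasure_pos (f : ℝ → ℝ) (ρ : ℝ) : ∀ᵐ r ∂(radiusMeasure f ρ), 0 < r :=
  (withDensity_absolutelyContinuous _ _).ae_le (ae_restrict_mem measurableSet_Ioi)

/-- The weighted mass is integrable when centers are uniform, as soon as the weights have a first
moment and the radii a moment of order `d`. -/
lemma lintegral_enorm_weightedMass_ne_top (μ : SignedMeasure (Space d))
    (hG : Integrable (fun m => m) G)
    (hR : ∫⁻ r, ENNReal.ofReal (r ^ d) ∂(radiusMeasure f ρ) ≠ ∞) :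
    ∫⁻ z, ‖weightedMass μ z‖ₑ
      ∂((volume : Measure (Space d)).prod ((radiusMeasure f ρ).prod G)) ≠ ∞ := by
  have hm : Measurable fun z : Marked d => ‖weightedMass μ z‖ₑ := (measurable_weightedMass μ).enorm
  have hb := (measurable_signedMeasure_closedBall μ).enorm
  have hB : Measurable fun r : ℝ => ∫⁻ x, ‖μ (Metric.closedBall x r)‖ₑ := hb.lintegral_prod_left'
  have e1 (q : ℝ × ℝ) : ∫⁻ x, ‖weightedMass μ (x, q)‖ₑ =
      (∫⁻ x, ‖μ (Metric.closedBall x q.1)‖ₑ) * ‖q.2‖ₑ := by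
    simp only [weightedMass, enorm_mul, mul_comm ‖q.2‖ₑ]
    have hq : Measurable fun x : Space d => (x, q.1) := measurable_prodMk_right
    have hbq := hb.comp hq
    exact lintegral_mul_const _ hbq
  rw [lintegral_prod_symm' _ hm]
  simp only [e1]
  rw [lintegral_prod_mul hB.aemeasurable measurable_enorm.aemeasurable]
  refine ENNReal.mul_ne_top ?_ hG.2.ne
  refine ne_top_of_le_ne_top (b := μ.totalVariation Set.univ *
    volume (Metric.closedBall (0 : Space d) 1) *
      ∫⁻ r, ENNReal.ofReal (r ^ d) ∂(radiusMeasure f ρ)) ?_ ?_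
  · exact ENNReal.mul_ne_top (ENNReal.mul_ne_top (by simp) measure_closedBall_lt_top.ne) hR
  · rw [← lintegral_const_mul _ (by fun_prop)]
    refine lintegral_mono_ae ?_
    filter_upwards [ae_radiusMeasure_pos f ρ] with r hr
    exact lintegral_enorm_signedMeasure_closedBall_le μ hr.le

end WeightedMass

/-! ### The cluster kernel -/

section Cluster

variable {d : ℕ} {k : Space d → Space d → ℝ} {f : ℝ → ℝ} {G : Measure ℝ} [IsProbabilityMeasure G]
  {ρ : ℝ}

/-- The intensity `k(x, y) dx f(r/ρ) dr/ρ G(dm)` of the marked balls generated by a parent point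
at `y`, as a kernel in `y`. The density is truncated to `ℝ≥0`, which is
harmless for `k ≥ 0` and makes the kernel `s`-finite. -/
noncomputable def clusterKernel (k : Space d → Space d → ℝ) (f : ℝ → ℝ) (ρ : ℝ) (G : Measure ℝ)
    [IsProbabilityMeasure G] : Kernel (Space d) (Marked d) :=
  Kernel.withDensity
    (Kernel.const _ ((volume : Measure (Space d)).prod ((radiusMeasure f ρ).prod G)))
    fun y z => ((k z.1 y).toNNReal : ℝ≥0∞)

lemma measurable_density (hk : Measurable (Function.uncurry k)) :
    Measurable (Function.uncurry fun (y : Space d) (z : Marked d) => (k z.1 y).toNNReal) := by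
  have : Measurable fun q : Space d × Marked d => k q.2.1 q.1 :=
    hk.comp ((measurable_fst.comp measurable_snd).prodMk measurable_fst)
  exact this.real_toNNReal

lemma clusterKernel_apply (hk : Measurable (Function.uncurry k)) (y : Space d) :
    clusterKernel k f ρ G y =
      ((volume : Measure (Space d)).prod ((radiusMeasure f ρ).prod G)).withDensity
        fun z => ((k z.1 y).toNNReal : ℝ≥0∞) := by
  rw [clusterKernel, Kernel.withDensity_apply _ (measurable_density hk).coe_nnreal_ennreal]
  rfl

lemma measurable_density_right (hk : Measurable (Function.uncurry k)) (y : Space d) :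
    Measurable fun z : Marked d => (k z.1 y).toNNReal :=
  (measurable_density hk).comp (measurable_const.prodMk measurable_id)

lemma lintegral_clusterKernel (hk : Measurable (Function.uncurry k)) (y : Space d)
    {h : Marked d → ℝ≥0∞} (hh : Measurable h) :
    ∫⁻ z, h z ∂(clusterKernel k f ρ G y) = ∫⁻ z, (k z.1 y).toNNReal * h z
      ∂((volume : Measure (Space d)).prod ((radiusMeasure f ρ).prod G)) := by
  rw [clusterKernel_apply hk, lintegral_withDensity_eq_lintegral_mul _
    (measurable_density_right hk y).coe_nnreal_ennreal hh]
  rfl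

/-- The directing measure is the superposition of the clusters of the parent points. -/
lemma directing_eq_bind (hk : Measurable (Function.uncurry k)) (φ : Measure (Space d)) [SFinite φ] :
    directing k f ρ G φ = φ.bind (clusterKernel k f ρ G) := by
  have hk' : Measurable fun q : Space d × Space d => ENNReal.ofReal (k q.1 q.2) :=
    hk.ennreal_ofReal
  have hD : Measurable fun x => ∫⁻ y, ENNReal.ofReal (k x y) ∂φ := hk'.lintegral_prod_right'
  have hS : SFinite (shotNoise k φ) := by unfold shotNoise; infer_instance
  refine Measure.ext fun A hA => ?_
  rw [Measure.bind_apply hA (Kernel.aemeasurable _), directing, shotNoise,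
    prod_withDensity_left hD, withDensity_apply _ hA]
  have hd : Measurable fun q : Marked d × Space d => ENNReal.ofReal (k q.1.1 q.2) :=
    hk'.comp ((measurable_fst.comp measurable_fst).prodMk measurable_snd)
  rw [lintegral_lintegral_swap hd.aemeasurable]
  refine lintegral_congr fun y => ?_
  rw [clusterKernel_apply hk, withDensity_apply _ hA]
  rfl

/-- Fubini's theorem for the superposition of clusters, without finiteness of the shot-noise
density. -/
lemma integral_directing {F : Type*} [NormedAddCommGroup F] [NormedSpace ℝ F]
    (hk : Measurable (Function.uncurry k)) (φ : Measure (Space d)) [SFinite φ]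
    {h : Marked d → F} (hh : Integrable h (directing k f ρ G φ)) :
    ∫ z, h z ∂(directing k f ρ G φ) = ∫ y, ∫ z, h z ∂(clusterKernel k f ρ G y) ∂φ := by
  rw [directing_eq_bind hk φ] at hh ⊢
  have := Kernel.integral_comp (η := clusterKernel k f ρ G) (κ := Kernel.const Unit φ) (a := ())
    (f := h)
  simp only [Kernel.comp_apply, Kernel.const_apply] at this
  exact this hh

end Cluster

/-! ### The first moment of a law in the normal domain of attraction -/

section Moment

variable {G : Measure ℝ} [IsProbabilityMeasure G]

lemma norm_one_sub_charFun_le (m : Measure ℝ) [IsProbabilityMeasure m] {t δ : ℝ} (ht : |t| ≤ δ) :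
    ‖1 - charFun m t‖ ≤ ∫ x, min 2 (δ * |x|) ∂m := by
  have hi : Integrable (fun x : ℝ => Complex.exp (t * x * Complex.I)) m :=
    Integrable.of_bound (by fun_prop) 1 (ae_of_all _ fun x => norm_exp_le_one (by simp))
  have e : 1 - charFun m t = ∫ x : ℝ, (1 - Complex.exp (t * x * Complex.I)) ∂m := by
    rw [charFun_apply_real, integral_sub (integrable_const _) hi]
    simp
  have hδ : 0 ≤ δ := (abs_nonneg t).trans ht
  have hmin : Integrable (fun x : ℝ => min 2 (δ * |x|)) m := by
    refine Integrable.of_bound (by fun_prop) 2 (ae_of_all _ fun x => ?_)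
    rw [Real.norm_of_nonneg (by positivity)]
    exact min_le_left _ _
  rw [e]
  refine (norm_integral_le_integral_norm _).trans
    (integral_mono ((integrable_const _).sub hi).norm hmin fun x => ?_)
  refine le_min ?_ ?_
  · refine (norm_sub_le _ _).trans ?_
    have : ‖Complex.exp (t * x * Complex.I)‖ ≤ 1 := norm_exp_le_one (by simp)
    simpa using (by linarith : (1 : ℝ) + ‖Complex.exp (t * x * Complex.I)‖ ≤ 2)
  · rw [norm_sub_rev]
    refine (norm_exp_sub_one_le_norm (by simp)).trans ?_
    simp only [norm_mul, Complex.norm_real, Complex.norm_I, mul_one, Real.norm_eq_abs]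
    gcongr

/-- Centring constants only rotate the characteristic function of the sum. -/
lemma norm_charFun_map_sum_div_add (G : Measure ℝ) [IsProbabilityMeasure G] (n : ℕ) (c a t : ℝ) :
    ‖charFun ((Measure.pi fun _ : Fin n => G).map fun x => (∑ i, x i) / c + a) t‖ =
      ‖charFun G (t / c)‖ ^ n := by
  have h := congrFun (charFun_map_sum_pi_eq_prod fun _ : Fin n => G) (t / c)
  rw [charFun_apply_real, integral_map (by fun_prop) (by fun_prop)] at h
  simp only [Finset.prod_const, Finset.card_univ, Fintype.card_fin, Pi.pow_apply] at h
  rw [← norm_pow, ← h, charFun_apply_real, integral_map (by fun_prop) (by fun_prop)]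
  have e (x : Fin n → ℝ) : Complex.exp (t * ((∑ i, x i) / c + a : ℝ) * Complex.I) =
      Complex.exp (t * a * Complex.I) *
        Complex.exp ((t / c : ℝ) * (∑ i, x i : ℝ) * Complex.I) := by
    rw [← Complex.exp_add]
    push_cast
    ring_nf
  have e' : ‖Complex.exp (t * a * Complex.I)‖ = 1 := by
    exact_mod_cast Complex.norm_exp_ofReal_mul_I (t * a)
  simp only [e, integral_const_mul, norm_mul, e', one_mul]

lemma exists_integral_min_lt (S : Measure ℝ) [IsProbabilityMeasure S] {ε : ℝ} (hε : 0 < ε) :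
    ∃ δ > 0, ∫ x, min 2 (δ * |x|) ∂S < ε := by
  have h : Tendsto (fun j : ℕ => ∫ x, min 2 (1 / ((j : ℝ) + 1) * |x|) ∂S) atTop
      (𝓝 (∫ _, (0 : ℝ) ∂S)) := by
    refine tendsto_integral_of_dominated_convergence (fun _ => 2) (fun j => by fun_prop)
      (integrable_const _) (fun j => ae_of_all _ fun x => ?_) (ae_of_all _ fun x => ?_)
    · rw [Real.norm_of_nonneg (by positivity)]
      exact min_le_left _ _
    · have := (tendsto_one_div_add_atTop_nhds_zero_nat (𝕜 := ℝ)).mul_const |x|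
      simpa using (tendsto_const_nhds (x := (2 : ℝ))).min this
  rw [integral_zero] at h
  obtain ⟨j, hj⟩ := (h.eventually_lt_const hε).exists
  exact ⟨1 / ((j : ℝ) + 1), by positivity, hj⟩

/-- Convergence in law of the normalized sums gives equicontinuity at `0` of their characteristic
functions, of which only the modulus, free of the centring constants, is retained. -/
lemma InNormalDomainOfAttraction.le_norm_charFun_pow {α σ b : ℝ}
    (h : InNormalDomainOfAttraction G α σ b) :
    ∃ δ > 0, ∃ N : ℕ, ∀ n ≥ N, ∀ t : ℝ, |t| ≤ δ →
      3 / 4 ≤ ‖charFun G (t / (n : ℝ) ^ (1 / α))‖ ^ n := by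
  obtain ⟨S, _, a, -, hconv⟩ := h
  obtain ⟨δ, hδ, hS⟩ := exists_integral_min_lt S (ε := 1 / 4) (by norm_num)
  refine ⟨δ, hδ, ?_⟩
  let F : BoundedContinuousFunction ℝ ℝ :=
    BoundedContinuousFunction.ofNormedAddCommGroup (fun x => min 2 (δ * |x|)) (by fun_prop) 2
      fun x => by
        rw [Real.norm_of_nonneg (by positivity)]
        exact min_le_left _ _
  have h1 := (ProbabilityMeasure.tendsto_iff_forall_integral_tendsto.1 hconv.tendsto) F
  have h2 : ∫ x, F x ∂(S.map fun x : ℝ => x) < 1 / 4 := by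
    rw [Measure.map_id']
    exact hS
  obtain ⟨N, hN⟩ := eventually_atTop.1 (h1.eventually_lt_const h2)
  refine ⟨N, fun n hn t ht => ?_⟩
  have := Measure.isProbabilityMeasure_map (hconv.forall_aemeasurable n)
  have h3 := (norm_one_sub_charFun_le
    ((Measure.pi fun _ : Fin n => G).map fun x => (∑ i, x i) / (n : ℝ) ^ (1 / α) + a n) ht).trans
      (hN n hn).le
  rw [← norm_charFun_map_sum_div_add G n _ (a n) t]
  have h4 := norm_sub_norm_le (1 : ℂ)
    (charFun ((Measure.pi fun _ : Fin n => G).map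
      fun x => (∑ i, x i) / (n : ℝ) ^ (1 / α) + a n) t)
  rw [norm_one] at h4
  linarith

lemma one_sub_le_inv_of_le_pow {x : ℝ} {n : ℕ} (hn : 0 < n) (hx : 0 ≤ x) (h : 9 / 16 ≤ x ^ n) :
    1 - x ≤ 1 / n := by
  have h1 : x ^ n ≤ Real.exp (-(n * (1 - x))) := by
    calc x ^ n ≤ (Real.exp (x - 1)) ^ n := by
          gcongr
          linarith [Real.add_one_le_exp (x - 1)]
      _ = Real.exp (-(n * (1 - x))) := by
          rw [← Real.exp_nat_mul]
          ring_nf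
  have h2 : Real.exp (-1) < Real.exp (-(n * (1 - x))) := by
    refine lt_of_lt_of_le ?_ (h.trans h1)
    rw [Real.exp_neg, inv_lt_comm₀ (Real.exp_pos 1) (by norm_num)]
    exact lt_trans (by norm_num) Real.exp_one_gt_d9
  have h3 := Real.exp_lt_exp.1 h2
  have hn' : (0 : ℝ) < n := by exact_mod_cast hn
  rw [le_div_iff₀ hn']
  linarith

/-- The characteristic function of the symmetrized law is `1 - O(|u| ^ α)` at `0`. -/
lemma InNormalDomainOfAttraction.one_sub_norm_charFun_sq_le {α σ b : ℝ} (hα : 0 < α)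
    (h : InNormalDomainOfAttraction G α σ b) :
    ∃ c, ∃ u₀ > 0, ∀ u, 0 < u → u ≤ u₀ → 1 - ‖charFun G u‖ ^ 2 ≤ c * u ^ α := by
  obtain ⟨δ, hδ, N, hN⟩ := h.le_norm_charFun_pow
  have hN1 : (0 : ℝ) < (N : ℝ) + 1 := by positivity
  refine ⟨2 / δ ^ α, δ / ((N : ℝ) + 1) ^ (1 / α), by positivity, fun u hu hu0 => ?_⟩
  -- the number of summands for which `u n ^ (1 / α)` is just below `δ`
  set n := ⌊(δ / u) ^ α⌋₊ with hn
  have hge : (N : ℝ) + 1 ≤ (δ / u) ^ α := by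
    have : ((N : ℝ) + 1) ^ (1 / α) ≤ δ / u := by
      rw [le_div_iff₀ hu]
      rwa [le_div_iff₀ (by positivity), mul_comm] at hu0
    calc (N : ℝ) + 1 = (((N : ℝ) + 1) ^ (1 / α)) ^ α := by
          rw [← Real.rpow_mul hN1.le, one_div_mul_cancel hα.ne', Real.rpow_one]
      _ ≤ _ := by gcongr
  have hnN : N + 1 ≤ n := Nat.le_floor (by exact_mod_cast hge)
  have hn0 : 0 < n := by omega
  have hn0' : (0 : ℝ) < n := by exact_mod_cast hn0
  have hle : (n : ℝ) ≤ (δ / u) ^ α := Nat.floor_le (by positivity)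
  have hlt : (δ / u) ^ α < n + 1 := Nat.lt_floor_add_one _
  have ht : |u * (n : ℝ) ^ (1 / α)| ≤ δ := by
    rw [abs_of_nonneg (by positivity), mul_comm, ← le_div_iff₀ hu]
    calc (n : ℝ) ^ (1 / α) ≤ ((δ / u) ^ α) ^ (1 / α) := by gcongr
      _ = δ / u := by
        rw [← Real.rpow_mul (by positivity), mul_one_div_cancel hα.ne', Real.rpow_one]
  have h1 := hN n (by omega) _ ht
  rw [mul_div_cancel_right₀ _ (by positivity)] at h1
  have h2 : 1 - ‖charFun G u‖ ^ 2 ≤ 1 / n := by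
    refine one_sub_le_inv_of_le_pow hn0 (by positivity) ?_
    rw [← pow_mul, mul_comm, pow_mul]
    calc (9 / 16 : ℝ) = (3 / 4) ^ 2 := by norm_num
      _ ≤ _ := by gcongr
  refine h2.trans ?_
  have h3 : (δ / u) ^ α ≤ 2 * n := by
    have : (1 : ℝ) ≤ n := by exact_mod_cast hn0
    linarith
  rw [Real.div_rpow hδ.le hu.le, div_le_iff₀ (by positivity)] at h3
  rw [div_mul_eq_mul_div, div_le_div_iff₀ hn0' (by positivity)]
  linarith

lemma integral_one_sub_cos_prod (G : Measure ℝ) [IsProbabilityMeasure G] (u : ℝ) :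
    ∫ p, (1 - Real.cos (u * (p.1 - p.2))) ∂(G.prod G) = 1 - ‖charFun G u‖ ^ 2 := by
  have hi : Integrable (fun p : ℝ × ℝ => Complex.exp ((u * (p.1 - p.2) : ℝ) * Complex.I))
      (G.prod G) :=
    Integrable.of_bound (by fun_prop) 1 (ae_of_all _ fun x => norm_exp_le_one (by simp))
  have e1 : ∫ p : ℝ × ℝ, Complex.exp ((u * (p.1 - p.2) : ℝ) * Complex.I) ∂(G.prod G) =
      ((‖charFun G u‖ ^ 2 : ℝ) : ℂ) := by
    have e (p : ℝ × ℝ) : Complex.exp ((u * (p.1 - p.2) : ℝ) * Complex.I) =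
        Complex.exp (u * p.1 * Complex.I) * Complex.exp ((-u : ℝ) * p.2 * Complex.I) := by
      rw [← Complex.exp_add]
      push_cast
      ring_nf
    simp only [e]
    rw [integral_prod_mul (fun x : ℝ => Complex.exp (u * x * Complex.I))
      (fun x : ℝ => Complex.exp ((-u : ℝ) * x * Complex.I)), ← charFun_apply_real,
      ← charFun_apply_real, charFun_neg, Complex.mul_conj, Complex.normSq_eq_norm_sq]
  have e2 := integral_re hi
  simp only [RCLike.re_eq_complex_re, Complex.exp_ofReal_mul_I_re] at e2
  rw [e1, Complex.ofReal_re] at e2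
  rw [integral_sub (integrable_const _) ?_, e2]
  · simp
  · exact Integrable.of_bound (by fun_prop) 1 (ae_of_all _ fun x => Real.abs_cos_le_one _)

/-- A lower bound of the right order for `∫₀^∞ (1 - cos (u x)) u⁻² du`. -/
lemma mul_abs_le_lintegral_one_sub_cos (x : ℝ) :
    ENNReal.ofReal ((1 - Real.cos 1) / 4 * |x|) ≤
      ∫⁻ u in Set.Ioi (0 : ℝ), ENNReal.ofReal ((1 - Real.cos (u * x)) / u ^ 2) := by
  rcases eq_or_ne x 0 with rfl | hx
  · simp
  have hx0 : 0 < |x| := abs_pos.2 hx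
  have hc : 0 ≤ 1 - Real.cos 1 := by linarith [Real.cos_le_one 1]
  -- for `u` in this interval `u |x|` is between `1` and `2`
  calc ENNReal.ofReal ((1 - Real.cos 1) / 4 * |x|)
      = ∫⁻ _ in Set.Icc (1 / |x|) (2 / |x|), ENNReal.ofReal ((1 - Real.cos 1) / 4 * |x| ^ 2) := by
        rw [setLIntegral_const, Real.volume_Icc, ← ENNReal.ofReal_mul (by positivity)]
        congr 1
        field_simp
        ring
    _ ≤ ∫⁻ u in Set.Icc (1 / |x|) (2 / |x|),
          ENNReal.ofReal ((1 - Real.cos (u * x)) / u ^ 2) := by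
        refine setLIntegral_mono' measurableSet_Icc fun u hu => ENNReal.ofReal_le_ofReal ?_
        have hu0 : 0 < u := lt_of_lt_of_le (by positivity) hu.1
        have h1 : 1 ≤ u * |x| := (div_le_iff₀ hx0).1 hu.1
        have h2 : u * |x| ≤ 2 := (le_div_iff₀ hx0).1 hu.2
        have h3 : Real.cos (u * x) ≤ Real.cos 1 := by
          rw [← Real.cos_abs, abs_mul, abs_of_pos hu0]
          exact Real.cos_le_cos_of_nonneg_of_le_pi zero_le_one
            (h2.trans Real.two_le_pi) h1
        rw [le_div_iff₀ (by positivity)]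
        have h4 : |x| ^ 2 * u ^ 2 ≤ 4 := by
          rw [← mul_pow, mul_comm]
          nlinarith
        calc (1 - Real.cos 1) / 4 * |x| ^ 2 * u ^ 2
            = (1 - Real.cos 1) / 4 * (|x| ^ 2 * u ^ 2) := by ring
          _ ≤ (1 - Real.cos 1) / 4 * 4 := by gcongr
          _ ≤ _ := by linarith
    _ ≤ _ := lintegral_mono_set fun u hu => lt_of_lt_of_le (by positivity) hu.1

/-- A law in the normal domain of attraction of a stable law of index `α > 1` has a first moment:
the bound `1 - O(|u| ^ α)` for the characteristic function of the symmetrized law makes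
`∫₀^∞ E[1 - cos (u (X - X'))] u⁻² du`, hence `E|X - X'|`, finite. -/
theorem InNormalDomainOfAttraction.integrable_id {α σ b : ℝ} (hα : 1 < α)
    (h : InNormalDomainOfAttraction G α σ b) : Integrable (fun m => m) G := by
  obtain ⟨c, u₀, hu₀, hc⟩ := h.one_sub_norm_charFun_sq_le (by linarith)
  have hcos (y : ℝ) : 0 ≤ 1 - Real.cos y := by linarith [Real.cos_le_one y]
  have hD : ∫⁻ u in Set.Ioi (0 : ℝ), ENNReal.ofReal ((1 - ‖charFun G u‖ ^ 2) / u ^ 2) < ∞ := by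
    have hm : Measurable fun u => (1 - ‖charFun G u‖ ^ 2) / u ^ 2 := by
      have : Measurable (charFun G) := measurable_charFun
      fun_prop
    have hnn (u : ℝ) : 0 ≤ 1 - ‖charFun G u‖ ^ 2 := by
      have := norm_charFun_le_one (μ := G) u
      nlinarith [norm_nonneg (charFun G u)]
    refine IntegrableOn.setLIntegral_lt_top ?_
    rw [← Set.Ioc_union_Ioi_eq_Ioi hu₀.le, integrableOn_union]
    constructor
    · have hi : IntegrableOn (fun u : ℝ => c * u ^ (α - 2)) (Set.Ioc 0 u₀) := by
        have := (intervalIntegral.intervalIntegrable_rpow' (a := 0) (b := u₀)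
          (by linarith : -1 < α - 2)).const_mul c
        rwa [intervalIntegrable_iff_integrableOn_Ioc_of_le hu₀.le] at this
      refine Integrable.mono' hi hm.aestronglyMeasurable ?_
      filter_upwards [ae_restrict_mem measurableSet_Ioc] with u hu
      have hu0 : 0 < u := hu.1
      rw [Real.norm_of_nonneg (div_nonneg (hnn u) (by positivity)), div_le_iff₀ (by positivity),
        mul_assoc, ← Real.rpow_natCast u 2, ← Real.rpow_add hu0]
      simpa using hc u hu0 hu.2
    · have hi : IntegrableOn (fun u : ℝ => u ^ (-2 : ℝ)) (Set.Ioi u₀) :=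
        integrableOn_Ioi_rpow_of_lt (by norm_num) hu₀
      refine Integrable.mono' hi hm.aestronglyMeasurable ?_
      filter_upwards [ae_restrict_mem measurableSet_Ioi] with u hu
      have hu0 : 0 < u := hu₀.trans hu
      rw [Real.norm_of_nonneg (div_nonneg (hnn u) (by positivity)), Real.rpow_neg hu0.le,
        ← one_div, Real.rpow_two]
      gcongr
      linarith [sq_nonneg ‖charFun G u‖]
  have hsym : ∫⁻ p, ENNReal.ofReal ((1 - Real.cos 1) / 4 * |p.1 - p.2|) ∂(G.prod G) < ∞ := by
    refine lt_of_le_of_lt (lintegral_mono fun p => mul_abs_le_lintegral_one_sub_cos _) ?_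
    rw [lintegral_lintegral_swap (by fun_prop)]
    refine lt_of_eq_of_lt (lintegral_congr fun u => ?_) hD
    rw [← integral_one_sub_cos_prod, ← integral_div, ofReal_integral_eq_lintegral_ofReal]
    · refine Integrable.div_const ?_ _
      refine Integrable.of_bound (by fun_prop) 2 (ae_of_all _ fun p => ?_)
      rw [Real.norm_of_nonneg (hcos _)]
      linarith [Real.neg_one_le_cos (u * (p.1 - p.2))]
    · exact ae_of_all _ fun p => div_nonneg (hcos _) (sq_nonneg u)
  have hc1 : 0 < (1 - Real.cos 1) / 4 := by
    have := Real.cos_one_le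
    linarith
  have hint : Integrable (fun p : ℝ × ℝ => p.1 - p.2) (G.prod G) := by
    have h1 : Integrable (fun p : ℝ × ℝ => (1 - Real.cos 1) / 4 * |p.1 - p.2|) (G.prod G) :=
      ⟨by fun_prop, by
        rw [hasFiniteIntegral_iff_ofReal (ae_of_all _ fun p => by positivity)]
        exact hsym⟩
    have h2 := h1.const_mul ((1 - Real.cos 1) / 4)⁻¹
    simp only [inv_mul_cancel_left₀ hc1.ne'] at h2
    exact (integrable_norm_iff (by fun_prop)).1 h2
  -- freeze one of the two independent copies
  obtain ⟨y, hy⟩ := hint.prod_left_ae.exists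
  exact (hy.add (integrable_const y)).congr (ae_of_all _ fun x => sub_add_cancel x y)

end Moment

/-! ### The cluster exponent -/

section Exponent

variable {d : ℕ} {k : Space d → Space d → ℝ} {f : ℝ → ℝ} {G : Measure ℝ} [IsProbabilityMeasure G]
  {ρ : ℝ}

instance : IsSFiniteKernel (clusterKernel k f ρ G) := by
  unfold clusterKernel; infer_instance

/-- The cluster exponent at `y` is the integral of `ψ` over the marked balls generated by a parent
point at `y`. -/
lemma clusterIntegrand_integrable_and_integral (hk : Measurable (Function.uncurry k))
    (hk0 : ∀ x y, 0 ≤ k x y) (hf : Measurable f) (hf0 : ∀ r, 0 < r → 0 ≤ f r) (hρ : 0 < ρ)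
    (μ : SignedMeasure (Space d)) (n θ : ℝ) {y : Space d}
    (hy : Integrable (weightedMass μ) (clusterKernel k f ρ G y)) :
    Integrable (clusterIntegrand k f ρ G μ n θ y)
        (volume.prod (volume.restrict (Set.Ioi (0 : ℝ)))) ∧
      clusterExponent k f ρ G μ n θ y =
        ∫ z, psi (θ / n * weightedMass μ z) ∂(clusterKernel k f ρ G y) := by
  have hg : Measurable fun z => θ / n * weightedMass μ z := (measurable_weightedMass μ).const_mul _
  have h1 : Integrable (fun z => psi (θ / n * weightedMass μ z)) (clusterKernel k f ρ G y) :=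
    integrable_psi_comp hg (hy.const_mul _)
  rw [clusterKernel_apply hk] at h1 ⊢
  rw [integrable_withDensity_iff_integrable_smul (measurable_density_right hk y)] at h1
  rw [integral_withDensity_eq_integral_smul (measurable_density_right hk y)]
  -- regroup `(x, r, m)` as `((x, r), m)` to integrate the weights out
  have hmp := measurePreserving_prodAssoc (volume : Measure (Space d)) (radiusMeasure f ρ) G
  rw [← hmp.integral_comp']
  rw [← hmp.integrable_comp_emb MeasurableEquiv.prodAssoc.measurableEmbedding] at h1
  have hrad : (volume : Measure (Space d)).prod (radiusMeasure f ρ) =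
      ((volume : Measure (Space d)).prod (volume.restrict (Set.Ioi (0 : ℝ)))).withDensity
        fun p => ((f (p.2 / ρ) / ρ).toNNReal : ℝ≥0∞) :=
    prod_withDensity_right (by fun_prop)
  have hfm : Measurable fun p : Space d × ℝ => (f (p.2 / ρ) / ρ).toNNReal := by fun_prop
  have hinner (p : Space d × ℝ) :
      ∫ m, (k p.1 y).toNNReal • psi (θ / n * weightedMass μ (p.1, p.2, m)) ∂G =
        (k p.1 y).toNNReal • psiG G (θ * μ (Metric.closedBall p.1 p.2) / n) := by
    simp only [NNReal.smul_def]
    rw [integral_smul, psiG]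
    congr 2
    ext m
    congr 1
    simp only [weightedMass]
    ring
  have hae : (fun p : Space d × ℝ => (f (p.2 / ρ) / ρ).toNNReal •
      ((k p.1 y).toNNReal • psiG G (θ * μ (Metric.closedBall p.1 p.2) / n)))
      =ᵐ[volume.prod (volume.restrict (Set.Ioi (0 : ℝ)))] clusterIntegrand k f ρ G μ n θ y := by
    have hpos : ∀ᵐ p : Space d × ℝ ∂(volume.prod (volume.restrict (Set.Ioi (0 : ℝ)))), 0 < p.2 :=
      Measure.quasiMeasurePreserving_snd.ae (ae_restrict_mem measurableSet_Ioi)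
    filter_upwards [hpos] with p hp
    have hf1 : 0 ≤ f (p.2 / ρ) / ρ := div_nonneg (hf0 _ (div_pos hp hρ)) hρ.le
    simp only [NNReal.smul_def, Complex.real_smul, clusterIntegrand, Real.coe_toNNReal _ hf1,
      Real.coe_toNNReal _ (hk0 p.1 y), Complex.ofReal_mul]
    ring
  change Integrable (fun q : (Space d × ℝ) × ℝ =>
    (k q.1.1 y).toNNReal • psi (θ / n * weightedMass μ (q.1.1, q.1.2, q.2))) _ at h1
  have h2 := h1.integral_prod_left
  simp only [hinner] at h2
  change _ ∧ _ = ∫ q : (Space d × ℝ) × ℝ,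
    (k q.1.1 y).toNNReal • psi (θ / n * weightedMass μ (q.1.1, q.1.2, q.2)) ∂_
  rw [integral_prod _ h1]
  simp only [hinner]
  rw [hrad] at h2 ⊢
  rw [integrable_withDensity_iff_integrable_smul hfm] at h2
  rw [integral_withDensity_eq_integral_smul hfm]
  exact ⟨h2.congr hae, (integral_congr_ae hae).symm⟩

end Exponent

/-! ### Means over the parent process -/

section Parents

variable {d : ℕ} {k : Space d → Space d → ℝ} {f : ℝ → ℝ} {G : Measure ℝ} [IsProbabilityMeasure G]
  {ρ : ℝ}

/-- Since `∫ k(x, y) dy` is bounded in `x`, summing the clusters over uniform parents gives a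
multiple of the uniform distribution of the centers. -/
lemma lintegral_lintegral_clusterKernel_ne_top (hk : Measurable (Function.uncurry k)) {c : ℝ≥0∞}
    (hc : c ≠ ∞) (hkc : ∀ x, ∫⁻ y, ENNReal.ofReal (k x y) ≤ c) {h : Marked d → ℝ≥0∞}
    (hh : Measurable h)
    (hfin : ∫⁻ z, h z ∂((volume : Measure (Space d)).prod ((radiusMeasure f ρ).prod G)) ≠ ∞) :
    ∫⁻ y, ∫⁻ z, h z ∂(clusterKernel k f ρ G y) ≠ ∞ := by
  simp only [lintegral_clusterKernel hk _ hh]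
  have hm := (measurable_density hk).coe_nnreal_ennreal
  rw [lintegral_lintegral_swap (hm.mul (hh.comp measurable_snd)).aemeasurable]
  refine ne_top_of_le_ne_top (ENNReal.mul_ne_top hc hfin) ?_
  rw [← lintegral_const_mul _ hh]
  refine lintegral_mono fun z => ?_
  rw [lintegral_mul_const]
  · gcongr
    exact hkc z.1
  · exact hm.comp measurable_prodMk_right

/-- The integral of `ψ ∘ g` over the directing measure is the integral over the parents of its
cluster integrals, so the exponential functional of the parent process applies. -/
lemma integral_exp_integral_directing {Ω : Type*} [MeasurableSpace Ω] {P : Measure Ω}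
    [IsProbabilityMeasure P] {Φ : Ω → Measure (Space d)} {ν : Measure (Space d)}
    (hΦ : IsPoissonProcess Φ ν P) (hk : Measurable (Function.uncurry k)) {g : Marked d → ℝ}
    (hg : Measurable g) (hgν : ∫⁻ y, ∫⁻ z, ‖g z‖ₑ ∂(clusterKernel k f ρ G y) ∂ν ≠ ∞)
    (hgΛ : ∀ᵐ ω ∂P, Integrable g (directing k f ρ G (Φ ω))) :
    Integrable (fun y => ∫ z, psi (g z) ∂(clusterKernel k f ρ G y)) ν ∧
    ∫ ω, Complex.exp (∫ z, psi (g z) ∂(directing k f ρ G (Φ ω))) ∂P =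
      Complex.exp (∫ y, (Complex.exp (∫ z, psi (g z) ∂(clusterKernel k f ρ G y)) - 1) ∂ν) := by
  have hψ : Measurable fun z => psi (g z) := measurable_psi.comp hg
  have hWm : Measurable fun y => ∫ z, psi (g z) ∂(clusterKernel k f ρ G y) :=
    hψ.stronglyMeasurable.integral_kernel.measurable
  have hWi : Integrable (fun y => ∫ z, psi (g z) ∂(clusterKernel k f ρ G y)) ν := by
    refine ⟨hWm.aestronglyMeasurable, ?_⟩
    refine lt_of_le_of_lt (b := ∫⁻ y, 2 * ∫⁻ z, ‖g z‖ₑ ∂(clusterKernel k f ρ G y) ∂ν)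
      (lintegral_mono fun y => ?_) ?_
    · refine (enorm_integral_le_lintegral_enorm _).trans ?_
      rw [← lintegral_const_mul _ hg.enorm]
      refine lintegral_mono fun z => ?_
      rw [← enorm_norm (psi _), show (2 : ℝ≥0∞) * ‖g z‖ₑ = ‖2 * g z‖ₑ by
        rw [enorm_mul, Real.enorm_of_nonneg zero_le_two]; simp]
      rw [enorm_le_iff_norm_le, norm_norm, norm_mul, Real.norm_of_nonneg zero_le_two]
      exact norm_psi_le _
    · rw [lintegral_const_mul _ hg.enorm.lintegral_kernel]
      exact ENNReal.mul_lt_top (by simp) hgν.lt_top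
  refine ⟨hWi, ?_⟩
  rw [← hΦ.integral_exp_integral hWm hWi fun y => integral_psi_re_nonpos g]
  refine integral_congr_ae ?_
  filter_upwards [hgΛ, hΦ.ae_sFinite] with ω h1 h2
  rw [integral_directing hk _ (integrable_psi_comp hg h1)]

end Parents

end ShotNoiseBalls

/-! ### The characteristic function of the fluctuations -/

open ShotNoiseBalls in
theorem mainTheorem6
    {d : ℕ}
    -- distribution of the weights
    (α σ b : ℝ) (hα : 1 < α) (hα2 : α ≤ 2) (hσ : 0 ≤ σ) (hb : b ∈ Set.Icc (-1 : ℝ) 1)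
    (G : Measure ℝ) [IsProbabilityMeasure G] (hG : InNormalDomainOfAttraction G α σ b)
    -- distribution of the radii
    (β Cβ C₀ : ℝ) (hβ : (d : ℝ) < β) (hβα : β < α * d) (hCβ : 0 < Cβ) (hC₀ : 0 < C₀)
    (f : ℝ → ℝ) (hf_meas : Measurable f) (hf_nonneg : ∀ r, 0 < r → 0 ≤ f r)
    (hf_prob : ∫ r in Set.Ioi (0 : ℝ), f r = 1)
    (hf_tail : f ~[atTop] fun r => Cβ / r ^ (β + 1))
    (hf_le : ∀ r, 0 < r → f r ≤ C₀ / r ^ (β + 1))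
    -- the kernels
    (k : Space d → Space d → ℝ) (hk_meas : Measurable (Function.uncurry k))
    (hk_nonneg : ∀ x y, 0 ≤ k x y) (hk_int : ∀ x, ∫ y, k x y = 1)
    (κ lam n : ℝ → ℝ) (hκ : ∀ ρ ∈ Set.Ioo (0 : ℝ) 1, 0 < κ ρ)
    (hlam : ∀ ρ ∈ Set.Ioo (0 : ℝ) 1, 0 < lam ρ) (hn : ∀ ρ ∈ Set.Ioo (0 : ℝ) 1, 0 < n ρ)
    (kρ : ℝ → Space d → Space d → ℝ)
    (hkρ_meas : ∀ ρ ∈ Set.Ioo (0 : ℝ) 1, Measurable (Function.uncurry (kρ ρ)))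
    (hkρ_nonneg : ∀ ρ ∈ Set.Ioo (0 : ℝ) 1, ∀ x y, 0 ≤ kρ ρ x y)
    (hkρ_equiv : ∀ x y, (fun ρ => kρ ρ x y) ~[𝓝[>] (0 : ℝ)] fun ρ => lam ρ * k x y)
    (C₁ : ℝ) (hC₁ : 0 < C₁)
    (hkρ_le : ∀ ρ ∈ Set.Ioo (0 : ℝ) 1, ∀ x y, kρ ρ x y ≤ C₁ * lam ρ * k x y)
    -- the rescaled model at scale `ρ`
    (ρ : ℝ) (hρ : ρ ∈ Set.Ioo (0 : ℝ) 1)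
    {Ω : Type*} [MeasurableSpace Ω] (P : Measure Ω) [IsProbabilityMeasure P]
    (Φ : Ω → Measure (Space d))
    (hΦ : IsPoissonProcess Φ (ENNReal.ofReal (κ ρ) • volume) P)
    (C : Ω → Measure (Marked d))
    (hC : IsCoxProcess C (fun ω => directing (kρ ρ) f ρ G (Φ ω)) P)
    -- a finite signed measure
    (μ : SignedMeasure (Space d)) :
    (∀ᵐ ω ∂P, Integrable (weightedMass μ) (C ω)) ∧
    Integrable (fun ω => field μ (C ω)) P ∧
    (∀ u : ℝ, Integrable (fun m => psi (m * u)) G) ∧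
    ∀ θ : ℝ,
      (∀ᵐ y : Space d, Integrable (clusterIntegrand (kρ ρ) f ρ G μ (n ρ) θ y)
        (volume.prod (volume.restrict (Set.Ioi (0 : ℝ))))) ∧
      Integrable (fun y : Space d =>
        (1 - Complex.exp (clusterExponent (kρ ρ) f ρ G μ (n ρ) θ y)) * (κ ρ : ℂ)) ∧
      ∫ ω, Complex.exp (Complex.I * θ *
          (fluctuation P C (fun ω => directing (kρ ρ) f ρ G (Φ ω)) μ (n ρ) ω : ℂ)) ∂P =
        Complex.exp (-∫ y : Space d,
          (1 - Complex.exp (clusterExponent (kρ ρ) f ρ G μ (n ρ) θ y)) * (κ ρ : ℂ)) := by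

  have hρ0 : 0 < ρ := hρ.1
  have hκρ := hκ ρ hρ
  have hnρ := hn ρ hρ
  have hkm := hkρ_meas ρ hρ
  have hk0 := hkρ_nonneg ρ hρ
  have hGi : Integrable (fun m => m) G := hG.integrable_id hα
  -- a function that is not integrable has integral `0`, not `1`
  have hfi : IntegrableOn f (Set.Ioi 0) := by
    refine not_imp_comm.1 integral_undef ?_
    rw [hf_prob]
    exact one_ne_zero
  have hR := lintegral_pow_radiusMeasure_ne_top hβ hf_meas hf_nonneg hfi hf_le hρ0
  have hwm := measurable_weightedMass μ
  have hkc (x : Space d) : ∫⁻ y, ENNReal.ofReal (kρ ρ x y) ≤ ENNReal.ofReal (C₁ * lam ρ) := by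
    have hkx : Integrable (k x) := by
      refine not_imp_comm.1 integral_undef ?_
      rw [hk_int]
      exact one_ne_zero
    calc ∫⁻ y, ENNReal.ofReal (kρ ρ x y)
        ≤ ∫⁻ y, ENNReal.ofReal (C₁ * lam ρ) * ENNReal.ofReal (k x y) := by
          refine lintegral_mono fun y => ?_
          rw [← ENNReal.ofReal_mul (mul_nonneg hC₁.le (hlam ρ hρ).le)]
          exact ENNReal.ofReal_le_ofReal (hkρ_le ρ hρ x y)
      _ = ENNReal.ofReal (C₁ * lam ρ) := by
          rw [lintegral_const_mul' _ _ ENNReal.ofReal_ne_top,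
            ← ofReal_integral_eq_lintegral_ofReal hkx (ae_of_all _ (hk_nonneg x)), hk_int]
          simp
  have hQvol : ∫⁻ y, ∫⁻ z, ‖weightedMass μ z‖ₑ ∂(clusterKernel (kρ ρ) f ρ G y) ≠ ∞ :=
    lintegral_lintegral_clusterKernel_ne_top hkm ENNReal.ofReal_ne_top hkc hwm.enorm
      (lintegral_enorm_weightedMass_ne_top μ hGi hR)
  have hQm : Measurable fun y => ∫⁻ z, ‖weightedMass μ z‖ₑ ∂(clusterKernel (kρ ρ) f ρ G y) :=
    hwm.enorm.lintegral_kernel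
  have hΛ : ∫⁻ ω, ∫⁻ z, ‖weightedMass μ z‖ₑ ∂(directing (kρ ρ) f ρ G (Φ ω)) ∂P ≠ ∞ := by
    have e : ∫⁻ ω, ∫⁻ z, ‖weightedMass μ z‖ₑ ∂(directing (kρ ρ) f ρ G (Φ ω)) ∂P =
        ∫⁻ ω, ∫⁻ y, ∫⁻ z, ‖weightedMass μ z‖ₑ ∂(clusterKernel (kρ ρ) f ρ G y) ∂(Φ ω) ∂P := by
      refine lintegral_congr_ae ?_
      filter_upwards [hΦ.ae_sFinite] with ω hω
      rw [directing_eq_bind hkm, Measure.lintegral_bind (Kernel.aemeasurable _)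
        hwm.enorm.aemeasurable]
    rw [e, hΦ.lintegral_lintegral hQm, lintegral_smul_measure]
    exact ENNReal.mul_ne_top ENNReal.ofReal_ne_top hQvol
  refine ⟨hC.ae_integrable hwm hΛ, hC.integrable_integral hwm hΛ, fun u => ?_, fun θ => ?_⟩
  · exact integrable_psi_comp (by fun_prop) (hGi.mul_const u)
  have hQae : ∀ᵐ y : Space d, Integrable (weightedMass μ) (clusterKernel (kρ ρ) f ρ G y) := by
    filter_upwards [ae_lt_top hQm hQvol] with y hy
    exact ⟨hwm.aestronglyMeasurable, hy⟩
  set c : ℝ := θ / n ρ with hc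
  have hg : Measurable fun z => c * weightedMass μ z := hwm.const_mul c
  have hexp : ∀ᵐ y : Space d, Integrable (clusterIntegrand (kρ ρ) f ρ G μ (n ρ) θ y)
      (volume.prod (volume.restrict (Set.Ioi (0 : ℝ)))) ∧
      clusterExponent (kρ ρ) f ρ G μ (n ρ) θ y =
        ∫ z, psi (c * weightedMass μ z) ∂(clusterKernel (kρ ρ) f ρ G y) := by
    filter_upwards [hQae] with y hy
    exact clusterIntegrand_integrable_and_integral hkm hk0 hf_meas hf_nonneg hρ0 μ (n ρ) θ hy
  have hgν : ∫⁻ y, ∫⁻ z, ‖c * weightedMass μ z‖ₑ ∂(clusterKernel (kρ ρ) f ρ G y)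
      ∂(ENNReal.ofReal (κ ρ) • (volume : Measure (Space d))) ≠ ∞ := by
    simp only [enorm_mul, lintegral_const_mul _ hwm.enorm]
    rw [lintegral_smul_measure, lintegral_const_mul _ hQm]
    exact ENNReal.mul_ne_top ENNReal.ofReal_ne_top (ENNReal.mul_ne_top enorm_ne_top hQvol)
  have hgΛ : ∫⁻ ω, ∫⁻ z, ‖c * weightedMass μ z‖ₑ ∂(directing (kρ ρ) f ρ G (Φ ω)) ∂P ≠ ∞ := by
    simp only [enorm_mul, lintegral_const_mul _ hwm.enorm]
    rw [lintegral_const_mul' _ _ enorm_ne_top]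
    exact ENNReal.mul_ne_top enorm_ne_top hΛ
  obtain ⟨hWi, hW⟩ := integral_exp_integral_directing hΦ hkm hg hgν
    (ae_integrable_of_lintegral_ne_top hC.measurable_directing hg hgΛ)
  refine ⟨hexp.mono fun y hy => hy.1, ?_, ?_⟩
  · have hWi' : Integrable (fun y => ∫ z, psi (c * weightedMass μ z)
        ∂(clusterKernel (kρ ρ) f ρ G y)) (volume : Measure (Space d)) :=
      (integrable_smul_measure (by simpa using hκρ) ENNReal.ofReal_ne_top).1 hWi
    refine Integrable.mul_const ?_ _
    have hi : Integrable (fun y => 1 - Complex.exp (∫ z, psi (c * weightedMass μ z)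
        ∂(clusterKernel (kρ ρ) f ρ G y))) (volume : Measure (Space d)) := by
      refine hWi'.mono ?_ (ae_of_all _ fun y => ?_)
      · exact aestronglyMeasurable_const.sub
          (Complex.continuous_exp.comp_aestronglyMeasurable hWi'.1)
      · rw [norm_sub_rev]
        exact norm_exp_sub_one_le_norm (integral_psi_re_nonpos _)
    refine hi.congr ?_
    filter_upwards [hexp] with y hy
    rw [hy.2]
  · have hfl : ∀ᵐ ω ∂P, Complex.exp (Complex.I * θ *
          (fluctuation P C (fun ω => directing (kρ ρ) f ρ G (Φ ω)) μ (n ρ) ω : ℂ)) =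
        Complex.exp (Complex.I * ((∫ z, c * weightedMass μ z ∂(C ω) -
          ∫ z, c * weightedMass μ z ∂(directing (kρ ρ) f ρ G (Φ ω)) : ℝ) : ℂ)) := by
      filter_upwards [hC.condExp_integral hwm hΛ] with ω hω
      simp only [fluctuation, field]
      rw [hω, integral_const_mul, integral_const_mul, hc]
      congr 1
      push_cast
      ring
    rw [integral_congr_ae hfl, hC.integral_exp_centred hg hgΛ, hW, integral_smul_measure,
      ENNReal.toReal_ofReal hκρ.le, integral_mul_const, ← neg_mul, ← integral_neg, mul_comm,
      Complex.real_smul]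
    congr 2
    refine integral_congr_ae ?_
    filter_upwards [hexp] with y hy
    rw [hy.2, neg_sub]
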